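/- **Setting.** Let $q\in\mathbb C$, $q\ne0$, $|q|\neq1$, let $t\neq0$, $b_1b_2b_3b_4=1$, $b_6\ne0$. Write $(a;q)_\infty=\prod_{j\ge0}(1-aq^j)$ if $|q|<1$ and $(a;q)_\infty=1/(aq^{-1};q^{-1})_\infty$ if $|q|>1$, and let $$w(x;t)=\frac{(b_2x;q)_\infty(b_3x;q)_\infty(b_6^{-1}xt^{-1};q)_\infty}{(b_1x;q)_\infty(b_4x;q)_\infty(b_6xt^{-1};q)_\infty}.$$ Put $W+\Delta yV=b_6(1-b_1x)(1-b_4x)(t-b_6x)$, $W-\Delta yV=(1-b_2x)(1-b_3x)(b_6t-x)$, $R+\Delta uS=b_6^{-1}(b_6qt-x)$, $\Delta y=(q-1)x$, $\Delta u=(q-1)t$. Assume regularity: no zero $b_2^{-1},b_3^{-1},b_6t$ of $W-\Delta yV$ lies in $q^{\mathbb Z}$ times a zero $b_1^{-1},b_4^{-1},t/b_6$ of $W+\Delta yV$. Let $I[f]=\sum_{s\in\mathbb Z}(q-1)x_1q^sf(x_1q^s)-\sum_{s\in\mathbb Z}(q-1)x_0q^sf(x_0q^s)$ be the Thomae–Jackson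 $q$-integral, where each of $x_0,x_1$ is one of $b_2^{-1},b_3^{-1},b_6t$ if $|q|<1$, and one of $b_1^{-1},b_4^{-1},t/b_6$ if $|q|>1$ (so $w$ vanishes on each lattice from some point outwards). At each of the two times $t$ and $qt$ let $(p_n)_{n\ge0}$ be polynomials with $\deg p_n=n$ and $I[wp_mp_n]=\delta_{mn}$; let $\gamma_n$ be the leading coefficient of $p_n$, $a_n=\gamma_{n-1}/\gamma_n$, $q_n(x)=I\big[w\,p_n/(x-\cdot)\big]$. A hat denotes $t\mapsto qt$. For $n\ge1$ put $$Y_n(x;t)=\begin{pmatrix}p_n&q_n/w\\p_{n-1}&q_{n-1}/w\end{pmatrix},\qquad b_5=q^nb_1b_4b_6 .$$ With $\mathbb D F(z)=\frac{F(qz)-F(z)}{(q-1)z}$ and $\mathbb M F(z)=\frac12(F(qz)+F(z))$, the spectral and deformation matrices $A_n,B_n$ are defined by $\mathbb D_xY_n=A_n\mathbb M_xY_n$ and $\mathbb D_tY_n=B_n\mathbb M_tY_n$. Put $$A_n^*=(W+\Delta yV)\,(1-\tfrac12\Delta yA_n)^{-1}(1+\tfrac12\Delta yA_n)=\begin{pmatrix}\mathfrak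 W_{n,+}&-\mathfrak T_{n,+}\\ \mathfrak T_{n,-}&\mathfrak W_{n,-}\end{pmatrix}$$ (a polynomial matrix in $x$) and $$B_n^*=-(R+\Delta uS)\,(1-\tfrac12\Delta uB_n)^{-1}(1+\tfrac12\Delta uB_n)=\begin{pmatrix}\mathfrak R_{n,+}&-\mathfrak P_{n,+}\\ \mathfrak P_{n,-}&\mathfrak R_{n,-}\end{pmatrix}.$$ Let $g=g_n(t)$ be the zero of the linear polynomial $\mathfrak T_{n,+}(x;t)/x$, let $\hat g=g_n(qt)$, and let $f=f_n(t)$ be determined by $$qt\,\mathfrak W_{n,+}(\hat g;qt)=(\hat g-b_6qt)(b_6\hat g-qt)(1-f\hat g).$$ **Proposition.** Assume $n\ge1$, $b_5^2\ne q^{-1},1,q$, and $g\neq0,b_6t,b_6^{-1}t$, $\hat g\ne0,b_6qt,b_6^{-1}qt$, $fg\ne1$, $tg\neq b_5$. Then $\gamma_n,\hat\gamma_n,\gamma_{n-1},\hat\gamma_{n-1}\ne0$ and $b_5f\ne t$, and $$\mathfrak R_{n,+}=\frac{\hat\gamma_n}{b_6\gamma_n}\Big\{x+\frac1{1-b_5^2}\Big[-\frac{q(t^2b_6+g^2b_5^2b_6-tgb_5^2(1+b_6^2))}{gb_6}+\frac{qt^2b_5\prod_{i=1}^4(1-b_ig)}{g(fg-1)(tg-b_5)}-\frac{q\prod_{i=1}^4(t-b_ib_5)}{(tg-b_5)(fb_5-t)}\Big]\Big\},$$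 $$\mathfrak R_{n,-}=\frac{b_6\gamma_{n-1}}{\hat\gamma_{n-1}}\Big\{x+\frac1{1-b_5^2}\Big[\frac{q(t^2b_6+g^2b_5^2b_6-tg(1+b_6^2))}{gb_6}-\frac{qt^2b_5\prod_{i=1}^4(1-b_ig)}{g(fg-1)(tg-b_5)}+\frac{q\prod_{i=1}^4(t-b_ib_5)}{(tg-b_5)(fb_5-t)}\Big]\Big\},$$ $$\mathfrak P_{n,+}=a_n\Big[\frac{\hat\gamma_n}{b_6\gamma_n}-\frac{b_6\gamma_n}{\hat\gamma_n}\Big],\qquad \mathfrak P_{n,-}=a_n\Big[\frac{\hat\gamma_{n-1}}{b_6\gamma_{n-1}}-\frac{b_6\gamma_{n-1}}{\hat\gamma_{n-1}}\Big].$$ These hold for every $x\neq0$ outside the $q$-lattices generated by the zeros of $W^2-\Delta y^2V^2$ at which $\mathbb M_tY_n(x)$ is invertible (so that $B_n$ is defined); moreover, with $B_n^*$ denoting the matrix of these linear polynomials, $-(R+\Delta uS)\,Y_n(x;qt)=B_n^*(x;t)\,Y_n(x;t)$ for all $x\ne0$ outside those lattices. -/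

import Mathlib

open Polynomial

/-- Constant data of the deformed big `q`-Jacobi system: the base `q`, the parameters
`b₁, b₂, b₃, b₄, b₆`, and the basal points `x0`, `x1` of the two lattices carrying the
orthogonality. -/
structure QJacobi where
  q : ℂ
  b1 : ℂ
  b2 : ℂ
  b3 : ℂ
  b4 : ℂ
  b6 : ℂ
  x0 : ℂ
  x1 : ℂ

namespace QJacobi

noncomputable section

/-- The `q`-shifted factorial `(a; q)_∞`: `∏_{j ≥ 0} (1 - a q^j)` for `|q| < 1`, with the standard
continuation `1 / (a q⁻¹; q⁻¹)_∞` for `|q| > 1`; in both cases `(a; q)_∞ = (1 - a) (a q; q)_∞`. -/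
def qPoch (q a : ℂ) : ℂ :=
  open Classical in
  if ‖q‖ < 1 then ∏' j : ℕ, (1 - a * q ^ j) else (∏' j : ℕ, (1 - a * (q⁻¹) ^ (j + 1)))⁻¹

/-- The deformed weight `w(x; t)`. -/
def weight (D : QJacobi) (t x : ℂ) : ℂ :=
  (qPoch D.q (D.b2 * x) * qPoch D.q (D.b3 * x) * qPoch D.q (x / (D.b6 * t))) /
    (qPoch D.q (D.b1 * x) * qPoch D.q (D.b4 * x) * qPoch D.q (D.b6 * x / t))

/-- The difference `ι₊(z) - ι₋(z) = q z - z`; it is `Δy` at `z = x` and `Δu` at `z = t`. -/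
def delta (D : QJacobi) (z : ℂ) : ℂ := (D.q - 1) * z

/-- The `𝔻`-integral over the `q`-linear lattice `{c q^s : s ∈ ℤ}`. -/
def latticeIntegral (D : QJacobi) (c : ℂ) (f : ℂ → ℂ) : ℂ :=
  ∑' s : ℤ, D.delta (c * D.q ^ s) * f (c * D.q ^ s)

/-- The Thomae-Jackson `q`-integral with the two terminals given by `x0` and `x1`. For basal points
as in `IsTerminal` the weight vanishes at all lattice points outside the terminal. -/
def integral (D : QJacobi) (f : ℂ → ℂ) : ℂ :=
  D.latticeIntegral D.x1 f - D.latticeIntegral D.x0 f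

/-- `c` is a basal point of a lattice on which the weight has zeros from some point outwards:
these are the zeros `b₂⁻¹, b₃⁻¹, b₆ t` of the numerator if `|q| < 1`,
and `b₁⁻¹, b₄⁻¹, t / b₆`, coming from the denominator, if `|q| > 1`. -/
def IsTerminal (D : QJacobi) (t c : ℂ) : Prop :=
  (‖D.q‖ < 1 ∧ (c = D.b2⁻¹ ∨ c = D.b3⁻¹ ∨ c = D.b6 * t)) ∨
  (1 < ‖D.q‖ ∧ (c = D.b1⁻¹ ∨ c = D.b4⁻¹ ∨ c = t / D.b6))

/-- No zero of `W - Δy V` lies on the `q`-lattice generated by a zero of `W + Δy V`. -/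
def Regular (D : QJacobi) (t : ℂ) : Prop :=
  ∀ c ∈ ({D.b2⁻¹, D.b3⁻¹, D.b6 * t} : Set ℂ), ∀ d ∈ ({D.b1⁻¹, D.b4⁻¹, t / D.b6} : Set ℂ),
    ∀ k : ℤ, c ≠ d * D.q ^ k

/-- `p` is the orthonormal polynomial system of the weight at time `t`. -/
structure IsOPS (D : QJacobi) (t : ℂ) (p : ℕ → ℂ[X]) : Prop where
  natDegree_eq : ∀ n, (p n).natDegree = n
  orthonormal : ∀ m n,
    D.integral (fun y => D.weight t y * (p m).eval y * (p n).eval y) = if m = n then 1 else 0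

/-- The leading coefficient `γ_n`. -/
def gam (p : ℕ → ℂ[X]) (n : ℕ) : ℂ := (p n).leadingCoeff

/-- The coefficient `a_n = γ_{n-1} / γ_n` (`n ≥ 1`) of the three-term recurrence
`a_{n+1} p_{n+1} = (x - b_n) p_n - a_n p_{n-1}`. -/
def recA (p : ℕ → ℂ[X]) (n : ℕ) : ℂ := gam p (n - 1) / gam p n

/-- The associated function (function of the second kind) `q_n(x; t)`. -/
def assoc (D : QJacobi) (t : ℂ) (p : ℕ → ℂ[X]) (n : ℕ) (x : ℂ) : ℂ :=
  D.integral (fun y => D.weight t y * (p n).eval y / (x - y))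

/-- The matrix variable `Y_n(x; t)`, `n ≥ 1`; `P t` is the orthonormal system at time `t`. -/
def Y (D : QJacobi) (P : ℂ → ℕ → ℂ[X]) (n : ℕ) (t x : ℂ) : Matrix (Fin 2) (Fin 2) ℂ :=
  !![(P t n).eval x, D.assoc t (P t) n x / D.weight t x;
     (P t (n - 1)).eval x, D.assoc t (P t) (n - 1) x / D.weight t x]

/-- The divided-difference operator `𝔻`, `(F(q z) - F(z)) / (q z - z)`. -/
def ddo (D : QJacobi) (F : ℂ → Matrix (Fin 2) (Fin 2) ℂ) (z : ℂ) : Matrix (Fin 2) (Fin 2) ℂ :=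
  (D.delta z)⁻¹ • (F (D.q * z) - F z)

/-- The mean operator `𝕄`, `(F(q z) + F(z)) / 2`. -/
def mean (D : QJacobi) (F : ℂ → Matrix (Fin 2) (Fin 2) ℂ) (z : ℂ) : Matrix (Fin 2) (Fin 2) ℂ :=
  (2 : ℂ)⁻¹ • (F (D.q * z) + F z)

/-- The Cayley transform `(1 - ½ δ M)⁻¹ (1 + ½ δ M)`. -/
def cayley (δ : ℂ) (M : Matrix (Fin 2) (Fin 2) ℂ) : Matrix (Fin 2) (Fin 2) ℂ :=
  (1 - (δ / 2) • M)⁻¹ * (1 + (δ / 2) • M)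

/-- `x` is neither `0` nor on one of the lattices generated by the zeros of `W² - Δy² V²`; then
`x` is off the support and the weight is finite and nonzero at `x` and `q x`. -/
def Admissible (D : QJacobi) (t x : ℂ) : Prop :=
  x ≠ 0 ∧ ∀ c ∈ ({D.b1⁻¹, D.b2⁻¹, D.b3⁻¹, D.b4⁻¹, D.b6 * t, t / D.b6} : Set ℂ),
    ∀ k : ℤ, x ≠ c * D.q ^ k

/-- The parameter `b₅ = q^n b₁ b₄ b₆`. -/
def b5 (D : QJacobi) (n : ℕ) : ℂ := D.q ^ n * (D.b1 * D.b4 * D.b6)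

/-- The spectral data polynomial `W + Δy V`. -/
def specPlus (D : QJacobi) (t x : ℂ) : ℂ :=
  D.b6 * (1 - D.b1 * x) * (1 - D.b4 * x) * (t - D.b6 * x)

/-- The deformation data polynomial `R + Δu S`. -/
def defPlus (D : QJacobi) (t x : ℂ) : ℂ := D.b6⁻¹ * (D.b6 * D.q * t - x)

/-- The spectral matrix `A_n(x; t)`, defined by `𝔻_x Y_n = A_n 𝕄_x Y_n`. -/
def specMatrix (D : QJacobi) (P : ℂ → ℕ → ℂ[X]) (n : ℕ) (t x : ℂ) : Matrix (Fin 2) (Fin 2) ℂ :=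
  D.ddo (D.Y P n t) x * (D.mean (D.Y P n t) x)⁻¹

/-- The polynomial matrix `A` is `(W + Δy V)` times the Cayley transform of the spectral matrix,
wherever the latter is defined. -/
def IsSpecStar (D : QJacobi) (P : ℂ → ℕ → ℂ[X]) (n : ℕ) (t : ℂ)
    (A : Matrix (Fin 2) (Fin 2) ℂ[X]) : Prop :=
  ∀ x, D.Admissible t x → (D.mean (D.Y P n t) x).det ≠ 0 →
    A.map (fun r => r.eval x) = D.specPlus t x • cayley (D.delta x) (D.specMatrix P n t x)

/-- The polynomial matrix `A*_n(·; t)`, with rows `(𝔚₊, -𝔗₊)` and `(𝔗₋, 𝔚₋)`. -/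
def specStar (D : QJacobi) (P : ℂ → ℕ → ℂ[X]) (n : ℕ) (t : ℂ) : Matrix (Fin 2) (Fin 2) ℂ[X] :=
  Classical.epsilon (D.IsSpecStar P n t)

/-- The polynomial `Θ_n`, where `𝔗₊ = Δy a_n Θ_n`. -/
def Theta (D : QJacobi) (P : ℂ → ℕ → ℂ[X]) (n : ℕ) (t : ℂ) : ℂ[X] :=
  C ((D.q - 1) * recA (P t) n)⁻¹ * (-(D.specStar P n t 0 1)).divX

/-- `g_n(t) = λ_n(t)`, the zero of the linear polynomial `Θ_n`. -/
def g (D : QJacobi) (P : ℂ → ℕ → ℂ[X]) (n : ℕ) (t : ℂ) : ℂ :=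
  -(D.Theta P n t).coeff 0 / (D.Theta P n t).coeff 1

/-- `ν_n = (2 W_n - W)(λ_n; t)`, where `𝔚_± = 2 W_n - W ± Δy (Ω_n + V)`. -/
def nu (D : QJacobi) (P : ℂ → ℕ → ℂ[X]) (n : ℕ) (t : ℂ) : ℂ :=
  ((D.specStar P n t 0 0).eval (D.g P n t) + (D.specStar P n t 1 1).eval (D.g P n t)) / 2

/-- `μ_n = (Ω_n + V)(λ_n; t)`. -/
def mu (D : QJacobi) (P : ℂ → ℕ → ℂ[X]) (n : ℕ) (t : ℂ) : ℂ :=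
  ((D.specStar P n t 0 0).eval (D.g P n t) - (D.specStar P n t 1 1).eval (D.g P n t)) /
    (2 * D.delta (D.g P n t))

/-- The variable `z₊`, from `ν_n = ½ λ_n (κ₊ z₊ + κ₋ z₋)` and
`μ_n = (κ₊ z₊ - κ₋ z₋) / (2 (q - 1))` with `κ₊ = -b₅ b₆`. -/
def zPlus (D : QJacobi) (P : ℂ → ℕ → ℂ[X]) (n : ℕ) (t : ℂ) : ℂ :=
  (D.nu P n t / D.g P n t + (D.q - 1) * D.mu P n t) / (-(D.b5 n * D.b6))

/-- The variable `Z`. -/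
def Z (D : QJacobi) (P : ℂ → ℕ → ℂ[X]) (n : ℕ) (t : ℂ) : ℂ :=
  -(D.b5 n * D.b6 * t) / ((D.g P n t - D.b6 * t) * (D.b6 * D.g P n t - t)) * D.zPlus P n t
    + (D.b5 n * t * D.g P n t - 1) / D.g P n t

/-- `f_n(t)`, from `Z(s) = b₅ s - f_n(q⁻¹ s)` at `s = q t`. -/
def f (D : QJacobi) (P : ℂ → ℕ → ℂ[X]) (n : ℕ) (t : ℂ) : ℂ :=
  D.b5 n * (D.q * t) - D.Z P n (D.q * t)

/-- The matrix `Y_n(x; ·)` as a function of the deformation variable. -/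
def YT (D : QJacobi) (P : ℂ → ℕ → ℂ[X]) (n : ℕ) (x : ℂ) : ℂ → Matrix (Fin 2) (Fin 2) ℂ :=
  fun s => D.Y P n s x

/-- The deformation matrix `B_n(x; t)`, defined by `𝔻_t Y_n = B_n 𝕄_t Y_n`. -/
def defMatrix (D : QJacobi) (P : ℂ → ℕ → ℂ[X]) (n : ℕ) (t x : ℂ) : Matrix (Fin 2) (Fin 2) ℂ :=
  D.ddo (D.YT P n x) t * (D.mean (D.YT P n x) t)⁻¹

/-- The decoupling constant `H_n`, which normalises `B*_n`. -/
def decoupling (P : ℂ → ℕ → ℂ[X]) (n : ℕ) (t : ℂ) : ℂ := -(recA (P t) n) / 2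

/-- The matrix `B*_n(x; t)`, with rows `(ℜ₊, -𝔓₊)` and `(𝔓₋, ℜ₋)`: the Cayley transform of the
deformation matrix equals `a_n(t) / (2 H_n (R + Δu S)) • B*_n`. -/
def defStar (D : QJacobi) (P : ℂ → ℕ → ℂ[X]) (n : ℕ) (t x : ℂ) : Matrix (Fin 2) (Fin 2) ℂ :=
  (2 * decoupling P n t * D.defPlus t x / recA (P t) n) •
    cayley (D.delta t) (D.defMatrix P n t x)

end

end QJacobi

namespace QJacobi

open Filter Topology

/-! ### The `q`-shifted factorial -/

/-! The weight obeys a first-order `q`-difference equation in `x` and another in `t`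
(`OffPoles.weight_mul`, `OffPoles.weight_time`). If two weights satisfy `α w₁ = β w₂` on the
lattices with polynomials `α`, `β`, then the bilinear combination of polynomials and Cauchy
transforms in `eval_crossPoly` is a polynomial, whose degree and top coefficient are governed by
orthogonality. Since the Casoratian is `1 / a_n`, Cramer's rule turns this into a polynomial matrix
carrying `Y` to its shift (`IsSystem.transferMatrix_mul`). The choice `w₂ = w(q·; t)` gives `A*`,
and `w₂ = w(·; qt)` gives `B*`; `cayley_mul_inv` identifies them with the Cayley transforms that
define them.

Hence `B*` is explicit except for the constant terms `r₊`, `r₋` of its diagonal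
(`IsSystem.exists_defPoly`). For `A*` one obtains leading coefficients and values at `0`
(`IsSystem.exists_isSpecPoly`); the latter rest on the cancellation of the boundary terms at `0` of
the two lattices.

Computing `Y(qx; qt)` in two ways gives `IsSystem.compatibility`, with scalar quadratic factors on
either side. Regularity makes the two zeros of each factor distinct and keeps them off the zeros of
the other factor. At the zeros `b₆qt`, `qt/b₆` this gives two roots of a cubic; its value at `ĝ`,
where `𝔗₊` vanishes, yields `qt b₅²ρ² - t = b₅ f (ρ² - 1)` with `ρ = γ̂_n / (b₆ γ_n)`
(`ratio_relation`). At `b₆t`, `t/b₆` it gives a cubic and a quartic with the same two roots.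
Inserted into `det A*`, after division by the common quadratic, they give `𝔚₊ (1 - f x) - E x (x -
g) (-q b₅ b₆ x² + u x + r₊ b₆ / t) = b₆ t ∏ (1 - b_i x)`, where `E = (t - b₅ f) / (q b₅)`. The three
middle coefficients form a linear system for `r₊` and the two unknown coefficients of `𝔚₊`, solved
in `constant_term_elimination`. Finally `r₋` comes from the linear term of `det B*`. -/

lemma summable_norm_mul_pow {r : ℂ} (hr : ‖r‖ < 1) (a : ℂ) :
    Summable fun j : ℕ => ‖-(a * r ^ j)‖ := by
  simpa [norm_mul, norm_pow] using (summable_geometric_of_lt_one (norm_nonneg r) hr).mul_left ‖a‖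

lemma multipliable_one_sub_mul_pow {r : ℂ} (hr : ‖r‖ < 1) (a : ℂ) :
    Multipliable fun j : ℕ => 1 - a * r ^ j := by
  simpa [sub_eq_add_neg] using multipliable_one_add_of_summable (summable_norm_mul_pow hr a)

lemma tprod_one_sub_mul_pow_step {r : ℂ} (hr : ‖r‖ < 1) (a : ℂ) :
    ∏' j : ℕ, (1 - a * r ^ j) = (1 - a) * ∏' j : ℕ, (1 - r * a * r ^ j) := by
  have h : Multipliable fun j : ℕ => 1 - a * r ^ (j + 1) := by
    refine (multipliable_one_sub_mul_pow hr (r * a)).congr fun j => ?_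
    ring
  rw [tprod_eq_zero_mul' (f := fun j : ℕ => 1 - a * r ^ j) h]
  simp only [pow_zero, mul_one]
  congr 1
  exact tprod_congr fun j => by ring

lemma tprod_one_sub_mul_pow_ne_zero {r : ℂ} (hr : ‖r‖ < 1) {a : ℂ} (h : ∀ j : ℕ, a * r ^ j ≠ 1) :
    ∏' j : ℕ, (1 - a * r ^ j) ≠ 0 := by
  have := tprod_one_add_ne_zero_of_summable (f := fun j : ℕ => -(a * r ^ j))
    (fun j h0 => h j (by linear_combination -h0)) (summable_norm_mul_pow hr a)
  simpa [sub_eq_add_neg] using this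

lemma tprod_one_sub_mul_pow_eq_zero {r a : ℂ} {j : ℕ} (h : a * r ^ j = 1) :
    ∏' j : ℕ, (1 - a * r ^ j) = 0 :=
  tprod_of_exists_eq_zero ⟨j, by simp [h]⟩

lemma tendsto_tprod_one_sub_mul_pow {r : ℂ} (hr : ‖r‖ < 1) :
    Tendsto (fun a : ℂ => ∏' j : ℕ, (1 - a * r ^ j)) (𝓝 0) (𝓝 1) := by
  have := tendsto_tprod_one_add_of_dominated_convergence (𝓕 := 𝓝 (0 : ℂ))
    (f := fun a (j : ℕ) => -(a * r ^ j)) (g := 0) (bound := fun j => ‖r‖ ^ j)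
    (summable_geometric_of_lt_one (norm_nonneg r) hr)
    (fun j => by
      have : Continuous fun a : ℂ => -(a * r ^ j) := by fun_prop
      simpa using this.tendsto 0)
    (by
      filter_upwards [Metric.ball_mem_nhds (0 : ℂ) one_pos] with a ha j
      have ha : ‖a‖ < 1 := by simpa using ha
      rw [norm_neg, norm_mul, norm_pow]
      exact mul_le_of_le_one_left (by positivity) ha.le)
  simpa [sub_eq_add_neg] using this

lemma norm_inv_lt_one {q : ℂ} (h : 1 < ‖q‖) : ‖q⁻¹‖ < 1 := by
  rw [norm_inv]; exact inv_lt_one_of_one_lt₀ h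

lemma qPoch_of_lt {q : ℂ} (h : ‖q‖ < 1) (a : ℂ) : qPoch q a = ∏' j : ℕ, (1 - a * q ^ j) := by
  simp [qPoch, h]

lemma qPoch_of_gt {q : ℂ} (h : 1 < ‖q‖) (a : ℂ) :
    qPoch q a = (∏' j : ℕ, (1 - q⁻¹ * a * q⁻¹ ^ j))⁻¹ := by
  rw [qPoch, if_neg h.not_gt]
  congr 1
  exact tprod_congr fun j => by ring

lemma qPoch_inv_step_of_gt {q : ℂ} (h : 1 < ‖q‖) (a : ℂ) :
    (qPoch q (q * a))⁻¹ = (1 - a) * (qPoch q a)⁻¹ := by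
  have hq : q ≠ 0 := by rintro rfl; norm_num at h
  rw [qPoch_of_gt h, qPoch_of_gt h, inv_inv, inv_inv, inv_mul_cancel_left₀ hq]
  exact tprod_one_sub_mul_pow_step (norm_inv_lt_one h) a

/-- With `0⁻¹ = 0` the functional equation of the reciprocal can fail at zeros of the symbol when
`‖q‖ < 1`; for `‖q‖ > 1` the reciprocal is the convergent product and nothing need be excluded. In
`qPoch_step` the two cases are exchanged. -/
lemma qPoch_inv_step {q a : ℂ} (hq : ‖q‖ ≠ 1) (h : 1 < ‖q‖ ∨ ∀ k : ℤ, a * q ^ k ≠ 1) :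
    (qPoch q (q * a))⁻¹ = (1 - a) * (qPoch q a)⁻¹ := by
  rcases hq.lt_or_gt with h1 | h1
  · have ha : 1 - a ≠ 0 := by
      have := h.resolve_left h1.not_gt 0
      simp only [zpow_zero, mul_one] at this
      exact sub_ne_zero.2 this.symm
    rw [qPoch_of_lt h1 a, tprod_one_sub_mul_pow_step h1 a, qPoch_of_lt h1, mul_inv,
      mul_inv_cancel_left₀ ha]
  · exact qPoch_inv_step_of_gt h1 a

lemma qPoch_step {q a : ℂ} (hq : ‖q‖ ≠ 1) (h : ‖q‖ < 1 ∨ ∀ k : ℤ, a * q ^ k ≠ 1) :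
    qPoch q a = (1 - a) * qPoch q (q * a) := by
  rcases hq.lt_or_gt with h1 | h1
  · rw [qPoch_of_lt h1, qPoch_of_lt h1]
    exact tprod_one_sub_mul_pow_step h1 a
  · have ha : 1 - a ≠ 0 := by
      have := h.resolve_left h1.not_gt 0
      simp only [zpow_zero, mul_one] at this
      exact sub_ne_zero.2 this.symm
    have := congrArg Inv.inv (qPoch_inv_step_of_gt h1 a)
    rw [inv_inv, mul_inv, inv_inv] at this
    rw [this, mul_inv_cancel_left₀ ha]

lemma qPoch_ne_zero {q a : ℂ} (hq0 : q ≠ 0) (hq : ‖q‖ ≠ 1) (h : ∀ k : ℤ, a * q ^ k ≠ 1) :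
    qPoch q a ≠ 0 := by
  rcases hq.lt_or_gt with h1 | h1
  · rw [qPoch_of_lt h1]
    exact tprod_one_sub_mul_pow_ne_zero h1 fun j => by exact_mod_cast h j
  · rw [qPoch_of_gt h1]
    refine inv_ne_zero (tprod_one_sub_mul_pow_ne_zero (norm_inv_lt_one h1) fun j hj => ?_)
    apply h (-(j + 1 : ℤ))
    rw [zpow_neg, zpow_add_one₀ hq0, zpow_natCast, mul_inv, ← inv_pow]
    linear_combination hj

lemma qPoch_zpow_eq_zero {q : ℂ} (hq0 : q ≠ 0) (h : ‖q‖ < 1) {k : ℤ} (hk : k ≤ 0) :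
    qPoch q (q ^ k) = 0 := by
  rw [qPoch_of_lt h]
  refine tprod_one_sub_mul_pow_eq_zero (j := (-k).toNat) ?_
  rw [← zpow_natCast, ← zpow_add₀ hq0, Int.toNat_of_nonneg (by omega)]
  simp

lemma qPoch_zpow_inv_eq_zero {q : ℂ} (hq0 : q ≠ 0) (h : 1 < ‖q‖) {k : ℤ} (hk : 1 ≤ k) :
    (qPoch q (q ^ k))⁻¹ = 0 := by
  rw [qPoch_of_gt h, inv_inv]
  refine tprod_one_sub_mul_pow_eq_zero (j := (k - 1).toNat) ?_
  rw [← zpow_natCast, Int.toNat_of_nonneg (by omega), inv_zpow, zpow_sub_one₀ hq0]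
  field_simp

lemma tendsto_qPoch {q : ℂ} (hq : ‖q‖ ≠ 1) : Tendsto (qPoch q) (𝓝 0) (𝓝 1) := by
  rcases hq.lt_or_gt with h1 | h1
  · rw [funext (qPoch_of_lt h1)]
    exact tendsto_tprod_one_sub_mul_pow h1
  · rw [funext (qPoch_of_gt h1)]
    have h2 : Tendsto (fun a : ℂ => q⁻¹ * a) (𝓝 0) (𝓝 0) := by
      have : Continuous fun a : ℂ => q⁻¹ * a := by fun_prop
      simpa using this.tendsto 0
    simpa using ((tendsto_tprod_one_sub_mul_pow (norm_inv_lt_one h1)).comp h2).inv₀ one_ne_zero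

/-! ### The weight -/

/-- The standing assumptions on the constant data. -/
structure Nondegenerate (D : QJacobi) : Prop where
  q_ne : D.q ≠ 0
  norm_q_ne : ‖D.q‖ ≠ 1
  b6_ne : D.b6 ≠ 0
  prod_eq : D.b1 * D.b2 * D.b3 * D.b4 = 1

lemma Nondegenerate.b1_ne {D : QJacobi} (hD : D.Nondegenerate) : D.b1 ≠ 0 :=
  fun h => by simpa [h] using hD.prod_eq

lemma Nondegenerate.b2_ne {D : QJacobi} (hD : D.Nondegenerate) : D.b2 ≠ 0 :=
  fun h => by simpa [h] using hD.prod_eq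

lemma Nondegenerate.b3_ne {D : QJacobi} (hD : D.Nondegenerate) : D.b3 ≠ 0 :=
  fun h => by simpa [h] using hD.prod_eq

lemma Nondegenerate.b4_ne {D : QJacobi} (hD : D.Nondegenerate) : D.b4 ≠ 0 :=
  fun h => by simpa [h] using hD.prod_eq

lemma Nondegenerate.q_sub_one_ne {D : QJacobi} (hD : D.Nondegenerate) : D.q - 1 ≠ 0 :=
  fun h => hD.norm_q_ne (by rw [sub_eq_zero.1 h]; simp)

variable {D : QJacobi}

/-- The spectral data polynomial `W - Δy V`. -/
noncomputable def specMinus (D : QJacobi) (t x : ℂ) : ℂ :=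
  (1 - D.b2 * x) * (1 - D.b3 * x) * (D.b6 * t - x)

/-- The deformation data polynomial `R - Δu S`. -/
noncomputable def defMinus (D : QJacobi) (t x : ℂ) : ℂ := D.q * t - D.b6 * x

/-- `y` does not lie on the lattices containing the poles of the weight at time `t`. -/
def OffPoles (D : QJacobi) (t y : ℂ) : Prop :=
  (‖D.q‖ < 1 ∧ ∀ d ∈ ({D.b1⁻¹, D.b4⁻¹, t / D.b6} : Set ℂ), ∀ k : ℤ, y ≠ d * D.q ^ k) ∨
  (1 < ‖D.q‖ ∧ ∀ d ∈ ({D.b2⁻¹, D.b3⁻¹, D.b6 * t} : Set ℂ), ∀ k : ℤ, y ≠ d * D.q ^ k)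

lemma mul_zpow_ne_one {q a d y : ℂ} (hq : q ≠ 0) (had : a * d = 1)
    (h : ∀ k : ℤ, y ≠ d * q ^ k) (k : ℤ) : a * y * q ^ k ≠ 1 := by
  intro h1
  apply h (-k)
  have hk : q ^ k * q ^ (-k) = 1 := by rw [← zpow_add₀ hq]; simp
  linear_combination (d * q ^ (-k)) * h1 - y * (q ^ k * q ^ (-k)) * had - y * hk

lemma Admissible.offPoles (hD : D.Nondegenerate) {t x : ℂ} (h : D.Admissible t x) :
    D.OffPoles t x := by
  rcases hD.norm_q_ne.lt_or_gt with h1 | h1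
  · exact Or.inl ⟨h1, fun d hd => h.2 d (by rcases hd with rfl | rfl | rfl <;> simp)⟩
  · exact Or.inr ⟨h1, fun d hd => h.2 d (by rcases hd with rfl | rfl | rfl <;> simp)⟩

lemma OffPoles.numerator (hD : D.Nondegenerate) {t y : ℂ} (ht : t ≠ 0) (h : D.OffPoles t y) :
    (‖D.q‖ < 1 ∨ ∀ k : ℤ, D.b2 * y * D.q ^ k ≠ 1) ∧
    (‖D.q‖ < 1 ∨ ∀ k : ℤ, D.b3 * y * D.q ^ k ≠ 1) ∧
    (‖D.q‖ < 1 ∨ ∀ k : ℤ, y / (D.b6 * t) * D.q ^ k ≠ 1) := by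
  rcases h with h | ⟨-, h⟩
  · exact ⟨Or.inl h.1, Or.inl h.1, Or.inl h.1⟩
  · refine ⟨Or.inr ?_, Or.inr ?_, Or.inr ?_⟩
    · exact mul_zpow_ne_one hD.q_ne (mul_inv_cancel₀ hD.b2_ne) (h _ (by simp))
    · exact mul_zpow_ne_one hD.q_ne (mul_inv_cancel₀ hD.b3_ne) (h _ (by simp))
    · rw [div_eq_inv_mul]
      exact mul_zpow_ne_one hD.q_ne (inv_mul_cancel₀ (mul_ne_zero hD.b6_ne ht)) (h _ (by simp))

lemma OffPoles.denominator (hD : D.Nondegenerate) {t y : ℂ} (ht : t ≠ 0) (h : D.OffPoles t y) :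
    (1 < ‖D.q‖ ∨ ∀ k : ℤ, D.b1 * y * D.q ^ k ≠ 1) ∧
    (1 < ‖D.q‖ ∨ ∀ k : ℤ, D.b4 * y * D.q ^ k ≠ 1) ∧
    (1 < ‖D.q‖ ∨ ∀ k : ℤ, D.b6 * y / t * D.q ^ k ≠ 1) := by
  rcases h with ⟨-, h⟩ | h
  · refine ⟨Or.inr ?_, Or.inr ?_, Or.inr ?_⟩
    · exact mul_zpow_ne_one hD.q_ne (mul_inv_cancel₀ hD.b1_ne) (h _ (by simp))
    · exact mul_zpow_ne_one hD.q_ne (mul_inv_cancel₀ hD.b4_ne) (h _ (by simp))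
    · rw [mul_div_right_comm]
      have hb6 := hD.b6_ne
      exact mul_zpow_ne_one hD.q_ne (by field_simp) (h (t / D.b6) (by simp))
  · exact ⟨Or.inl h.1, Or.inl h.1, Or.inl h.1⟩

lemma weight_eq (t x : ℂ) :
    D.weight t x = qPoch D.q (D.b2 * x) * qPoch D.q (D.b3 * x) * qPoch D.q (x / (D.b6 * t)) *
      ((qPoch D.q (D.b1 * x))⁻¹ * (qPoch D.q (D.b4 * x))⁻¹ * (qPoch D.q (D.b6 * x / t))⁻¹) := by
  rw [weight, div_eq_mul_inv, mul_inv, mul_inv]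

lemma OffPoles.weight_mul (hD : D.Nondegenerate) {t y : ℂ} (ht : t ≠ 0) (h : D.OffPoles t y) :
    D.specMinus t y * D.weight t (D.q * y) = D.specPlus t y * D.weight t y := by
  obtain ⟨n1, n2, n3⟩ := h.numerator hD ht
  obtain ⟨d1, d2, d3⟩ := h.denominator hD ht
  have n1 := qPoch_step hD.norm_q_ne n1
  have n2 := qPoch_step hD.norm_q_ne n2
  have n3 := qPoch_step hD.norm_q_ne n3
  have d1 := qPoch_inv_step hD.norm_q_ne d1
  have d2 := qPoch_inv_step hD.norm_q_ne d2
  have d3 := qPoch_inv_step hD.norm_q_ne d3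
  have hb6 := hD.b6_ne
  rw [weight_eq, weight_eq, n1, n2, n3, specMinus, specPlus,
    show D.b1 * (D.q * y) = D.q * (D.b1 * y) by ring,
    show D.b4 * (D.q * y) = D.q * (D.b4 * y) by ring,
    show D.b2 * (D.q * y) = D.q * (D.b2 * y) by ring,
    show D.b3 * (D.q * y) = D.q * (D.b3 * y) by ring,
    show D.b6 * (D.q * y) / t = D.q * (D.b6 * y / t) by ring, mul_div_assoc D.q y, d1, d2, d3,
    show D.b6 * t - y = D.b6 * t * (1 - y / (D.b6 * t)) by field_simp,
    show t - D.b6 * y = t * (1 - D.b6 * y / t) by field_simp]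
  ring

/-- Only the factors containing `t` change, each by one step of the functional equation, started
from time `q t`; hence the off-pole condition at `q t`. -/
lemma OffPoles.weight_time (hD : D.Nondegenerate) {t y : ℂ} (ht : t ≠ 0)
    (h' : D.OffPoles (D.q * t) y) :
    D.defMinus t y * D.weight (D.q * t) y = D.defPlus t y * D.weight t y := by
  have hq := hD.q_ne
  have hb6 := hD.b6_ne
  obtain ⟨-, -, n3⟩ := h'.numerator hD (mul_ne_zero hq ht)
  obtain ⟨-, -, d3⟩ := h'.denominator hD (mul_ne_zero hq ht)
  have n3 := qPoch_step hD.norm_q_ne n3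
  have d3 := qPoch_inv_step hD.norm_q_ne d3
  rw [show D.q * (y / (D.b6 * (D.q * t))) = y / (D.b6 * t) by field_simp] at n3
  rw [show D.q * (D.b6 * y / (D.q * t)) = D.b6 * y / t by field_simp] at d3
  rw [weight_eq, weight_eq, n3, d3, defMinus, defPlus,
    show D.b6 * D.q * t - y = D.b6 * (D.q * t) * (1 - y / (D.b6 * (D.q * t))) by field_simp,
    show D.q * t - D.b6 * y = D.q * t * (1 - D.b6 * y / (D.q * t)) by field_simp]
  field_simp

lemma Admissible.weight_ne_zero (hD : D.Nondegenerate) {t x : ℂ} (ht : t ≠ 0)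
    (h : D.Admissible t x) : D.weight t x ≠ 0 := by
  have hq := hD.q_ne
  have hb6 := hD.b6_ne
  have key : ∀ a d : ℂ, d ∈ ({D.b1⁻¹, D.b2⁻¹, D.b3⁻¹, D.b4⁻¹, D.b6 * t, t / D.b6} : Set ℂ) →
      a * d = 1 → qPoch D.q (a * x) ≠ 0 := fun a d hd had =>
    qPoch_ne_zero hq hD.norm_q_ne (mul_zpow_ne_one hq had (h.2 d hd))
  have h1 := key D.b1 _ (by simp) (mul_inv_cancel₀ hD.b1_ne)
  have h2 := key D.b2 _ (by simp) (mul_inv_cancel₀ hD.b2_ne)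
  have h3 := key D.b3 _ (by simp) (mul_inv_cancel₀ hD.b3_ne)
  have h4 := key D.b4 _ (by simp) (mul_inv_cancel₀ hD.b4_ne)
  have h5 := key (D.b6 * t)⁻¹ (D.b6 * t) (by simp) (inv_mul_cancel₀ (mul_ne_zero hb6 ht))
  have h6 := key (D.b6 / t) (t / D.b6) (by simp) (by field_simp)
  rw [← div_eq_inv_mul] at h5
  rw [← mul_div_right_comm] at h6
  rw [weight]
  positivity

lemma tendsto_weight (hD : D.Nondegenerate) (t : ℂ) : Tendsto (D.weight t) (𝓝 0) (𝓝 1) := by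
  have key : ∀ a : ℂ, Tendsto (fun x => qPoch D.q (a * x)) (𝓝 0) (𝓝 1) := fun a => by
    have : Continuous fun x : ℂ => a * x := by fun_prop
    exact (tendsto_qPoch hD.norm_q_ne).comp (by simpa using this.tendsto 0)
  have h5 := key (D.b6 * t)⁻¹
  have h6 := key (D.b6 / t)
  simp only [← div_eq_inv_mul] at h5
  simp only [← mul_div_right_comm] at h6
  have := (((key D.b2).mul (key D.b3)).mul h5).div (((key D.b1).mul (key D.b4)).mul h6) (by simp)
  simp only [mul_one, div_one] at this
  exact this

/-- The lattice `{c q^k}` contains a terminal point of the weight at time `t`. -/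
def IsTerminalLattice (D : QJacobi) (t c : ℂ) : Prop := ∃ m : ℤ, D.IsTerminal t (c * D.q ^ m)

lemma IsTerminal.isTerminalLattice {t c : ℂ} (h : D.IsTerminal t c) : D.IsTerminalLattice t c :=
  ⟨0, by simpa using h⟩

/-- The terminals `b₆ t` and `t / b₆` move with time, but only by a factor `q` along their own
lattice. This is why later statements refer to the lattice and not to its basal point. -/
lemma IsTerminal.isTerminalLattice_mul {t c : ℂ} (h : D.IsTerminal t c) :
    D.IsTerminalLattice (D.q * t) c := by
  rcases h with ⟨h1, h | h | rfl⟩ | ⟨h1, h | h | rfl⟩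
  · exact ⟨0, Or.inl ⟨h1, by simp [h]⟩⟩
  · exact ⟨0, Or.inl ⟨h1, by simp [h]⟩⟩
  · exact ⟨1, Or.inl ⟨h1, by right; right; rw [zpow_one]; ring⟩⟩
  · exact ⟨0, Or.inr ⟨h1, by simp [h]⟩⟩
  · exact ⟨0, Or.inr ⟨h1, by simp [h]⟩⟩
  · exact ⟨1, Or.inr ⟨h1, by right; right; rw [zpow_one]; ring⟩⟩

lemma Regular.q_mul (hD : D.Nondegenerate) {t : ℂ} (h : D.Regular t) : D.Regular (D.q * t) := by
  have hq := hD.q_ne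
  have key : ∀ c c' d d' : ℂ, ∀ i j : ℤ, c' = c * D.q ^ i → d' = d * D.q ^ j →
      (∀ k : ℤ, c ≠ d * D.q ^ k) → ∀ k : ℤ, c' ≠ d' * D.q ^ k := by
    rintro c _ d _ i j rfl rfl h k hk
    apply h (j + k - i)
    rw [zpow_sub₀ hq, zpow_add₀ hq]
    field_simp
    linear_combination hk
  have hc : ∀ c' ∈ ({D.b2⁻¹, D.b3⁻¹, D.b6 * (D.q * t)} : Set ℂ),
      ∃ c ∈ ({D.b2⁻¹, D.b3⁻¹, D.b6 * t} : Set ℂ), ∃ i : ℤ, c' = c * D.q ^ i := by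
    rintro c' (rfl | rfl | rfl)
    · exact ⟨D.b2⁻¹, by simp, 0, by simp⟩
    · exact ⟨D.b3⁻¹, by simp, 0, by simp⟩
    · exact ⟨D.b6 * t, by simp, 1, by rw [zpow_one]; ring⟩
  have hd : ∀ c' ∈ ({D.b1⁻¹, D.b4⁻¹, D.q * t / D.b6} : Set ℂ),
      ∃ c ∈ ({D.b1⁻¹, D.b4⁻¹, t / D.b6} : Set ℂ), ∃ i : ℤ, c' = c * D.q ^ i := by
    rintro c' (rfl | rfl | rfl)
    · exact ⟨D.b1⁻¹, by simp, 0, by simp⟩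
    · exact ⟨D.b4⁻¹, by simp, 0, by simp⟩
    · exact ⟨t / D.b6, by simp, 1, by rw [zpow_one]; ring⟩
  intro c' hc' d' hd'
  obtain ⟨c, hcm, i, hi⟩ := hc c' hc'
  obtain ⟨d, hdm, j, hj⟩ := hd d' hd'
  exact key c c' d d' i j hi hj (h c hcm d hdm)

/-- For `‖q‖ < 1` the terminal is a zero of the numerator and the poles come from the denominator;
for `‖q‖ > 1` the roles are swapped. Regularity separates the lattices in both cases. -/
lemma IsTerminalLattice.offPoles (hD : D.Nondegenerate) {t c : ℂ} (hreg : D.Regular t)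
    (h : D.IsTerminalLattice t c) (k : ℤ) : D.OffPoles t (c * D.q ^ k) := by
  have hq := hD.q_ne
  obtain ⟨m, h⟩ := h
  rcases h with ⟨h1, h⟩ | ⟨h1, h⟩
  · refine Or.inl ⟨h1, fun d hd j hj => ?_⟩
    refine hreg _ h d hd (j + m - k) ?_
    rw [zpow_sub₀ hq, zpow_add₀ hq]
    field_simp
    linear_combination hj
  · refine Or.inr ⟨h1, fun d hd j hj => ?_⟩
    refine hreg d hd _ h (k - m - j) ?_
    rw [zpow_sub₀ hq, zpow_sub₀ hq]
    field_simp
    linear_combination -hj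

lemma IsTerminalLattice.ne_zero (hD : D.Nondegenerate) {t c : ℂ} (ht : t ≠ 0)
    (h : D.IsTerminalLattice t c) : c ≠ 0 := by
  obtain ⟨m, h⟩ := h
  rintro rfl
  simp [IsTerminal, hD.b1_ne, hD.b2_ne, hD.b3_ne, hD.b4_ne, hD.b6_ne, ht, eq_comm] at h

/-- The weight vanishes at the outer end of a terminal lattice. -/
lemma IsTerminalLattice.weight_eq_zero (hD : D.Nondegenerate) {t c : ℂ} (ht : t ≠ 0)
    (h : D.IsTerminalLattice t c) :
    (‖D.q‖ < 1 ∧ ∀ᶠ k : ℤ in atBot, D.weight t (c * D.q ^ k) = 0) ∨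
    (1 < ‖D.q‖ ∧ ∀ᶠ k : ℤ in atTop, D.weight t (c * D.q ^ k) = 0) := by
  have hq := hD.q_ne
  have hb6 := hD.b6_ne
  obtain ⟨m, h⟩ := h
  have e : ∀ k : ℤ, c * D.q ^ k = c * D.q ^ m * D.q ^ (k - m) := fun k => by
    rw [mul_assoc, ← zpow_add₀ hq]; congr 2; ring
  rcases h with ⟨h1, h⟩ | ⟨h1, h⟩
  · refine Or.inl ⟨h1, ?_⟩
    filter_upwards [eventually_le_atBot m] with k hk
    have h0 : qPoch D.q (D.q ^ (k - m)) = 0 := qPoch_zpow_eq_zero hq h1 (by omega)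
    rw [e, weight]
    rcases h with h | h | h
    · rw [h, mul_inv_cancel_left₀ hD.b2_ne, h0]; simp
    · rw [h, mul_inv_cancel_left₀ hD.b3_ne, h0]; simp
    · rw [h, mul_div_cancel_left₀ _ (mul_ne_zero hb6 ht), h0]; simp
  · refine Or.inr ⟨h1, ?_⟩
    -- The bound is `m + 1` and not `m`: for `‖q‖ > 1` the reciprocal of `(q^k; q)_∞` vanishes from
    -- `k = 1` on, whereas for `‖q‖ < 1` the symbol itself already vanishes at `k = 0`.
    filter_upwards [eventually_ge_atTop (m + 1)] with k hk
    have h0 := qPoch_zpow_inv_eq_zero hq h1 (k := k - m) (by omega)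
    rw [e, weight_eq]
    rcases h with h | h | h
    · rw [h, mul_inv_cancel_left₀ hD.b1_ne, h0]; simp
    · rw [h, mul_inv_cancel_left₀ hD.b4_ne, h0]; simp
    · rw [h, show D.b6 * (t / D.b6 * D.q ^ (k - m)) / t = D.q ^ (k - m) by field_simp, h0]; simp

/-! ### The `q`-integral -/

/-- The points of the two lattices of integration. -/
def latticePoints (D : QJacobi) : Set ℂ := {y | ∃ c, (c = D.x0 ∨ c = D.x1) ∧ ∃ k : ℤ, y = c * D.q ^ k}

/-- Absolute convergence of the `q`-integral on both lattices. -/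
def Integrable (D : QJacobi) (f : ℂ → ℂ) : Prop :=
  ∀ c, (c = D.x0 ∨ c = D.x1) → Summable fun k : ℤ => D.delta (c * D.q ^ k) * f (c * D.q ^ k)

lemma Integrable.congr {f g : ℂ → ℂ} (hf : D.Integrable f) (h : ∀ y ∈ D.latticePoints, f y = g y) :
    D.Integrable g := fun c hc => by
  simpa only [h _ ⟨c, hc, _, rfl⟩] using hf c hc

lemma Integrable.add {f g : ℂ → ℂ} (hf : D.Integrable f) (hg : D.Integrable g) :
    D.Integrable fun y => f y + g y := fun c hc => by
  simpa only [mul_add] using (hf c hc).add (hg c hc)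

lemma Integrable.sub {f g : ℂ → ℂ} (hf : D.Integrable f) (hg : D.Integrable g) :
    D.Integrable fun y => f y - g y := fun c hc => by
  simpa only [mul_sub] using (hf c hc).sub (hg c hc)

lemma Integrable.const_mul {f : ℂ → ℂ} (hf : D.Integrable f) (a : ℂ) :
    D.Integrable fun y => a * f y := fun c hc => by
  simpa only [mul_left_comm] using (hf c hc).mul_left a

lemma integral_congr {f g : ℂ → ℂ} (h : ∀ y ∈ D.latticePoints, f y = g y) :
    D.integral f = D.integral g := by
  simp only [integral, latticeIntegral, h _ ⟨_, Or.inl rfl, _, rfl⟩, h _ ⟨_, Or.inr rfl, _, rfl⟩]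

lemma integral_add {f g : ℂ → ℂ} (hf : D.Integrable f) (hg : D.Integrable g) :
    D.integral (fun y => f y + g y) = D.integral f + D.integral g := by
  simp only [integral, latticeIntegral, mul_add]
  rw [(hf _ (Or.inl rfl)).tsum_add (hg _ (Or.inl rfl)),
    (hf _ (Or.inr rfl)).tsum_add (hg _ (Or.inr rfl))]
  ring

lemma integral_const_mul (f : ℂ → ℂ) (a : ℂ) :
    D.integral (fun y => a * f y) = a * D.integral f := by
  simp only [integral, latticeIntegral, mul_left_comm _ a, tsum_mul_left]
  ring

lemma integral_sub {f g : ℂ → ℂ} (hf : D.Integrable f) (hg : D.Integrable g) :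
    D.integral (fun y => f y - g y) = D.integral f - D.integral g := by
  have := integral_add hf (hg.const_mul (-1))
  rw [integral_const_mul] at this
  rw [sub_eq_add_neg, ← neg_one_mul, ← this]
  congr 1
  funext y
  ring

lemma delta_mul_shift (hq : D.q ≠ 0) (f : ℂ → ℂ) (c : ℂ) (k : ℤ) :
    D.delta (c * D.q ^ k) * (D.q * f (D.q * (c * D.q ^ k))) =
      D.delta (c * D.q ^ (k + 1)) * f (c * D.q ^ (k + 1)) := by
  have : D.q * (c * D.q ^ k) = c * D.q ^ (k + 1) := by rw [zpow_add_one₀ hq]; ring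
  rw [this, zpow_add_one₀ hq, delta, delta]
  ring

lemma Integrable.shift (hq : D.q ≠ 0) {f : ℂ → ℂ} (hf : D.Integrable f) :
    D.Integrable fun y => D.q * f (D.q * y) := fun c hc => by
  simp only [delta_mul_shift hq]
  exact (Equiv.addRight (1 : ℤ)).summable_iff.2 (hf c hc)

lemma integral_shift (hq : D.q ≠ 0) (f : ℂ → ℂ) :
    D.integral (fun y => D.q * f (D.q * y)) = D.integral f := by
  simp only [integral, latticeIntegral, delta_mul_shift hq]
  congr 1
  · exact (Equiv.addRight (1 : ℤ)).tsum_eq fun k => D.delta (D.x1 * D.q ^ k) * f (D.x1 * D.q ^ k)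
  · exact (Equiv.addRight (1 : ℤ)).tsum_eq fun k => D.delta (D.x0 * D.q ^ k) * f (D.x0 * D.q ^ k)

/-- A function against which everything continuous at `0` is integrable. -/
def IsWeight (D : QJacobi) (w : ℂ → ℂ) : Prop :=
  ∀ G : ℂ → ℂ, ContinuousAt G 0 → D.Integrable fun y => w y * G y

lemma IsWeight.shift (hq : D.q ≠ 0) {w : ℂ → ℂ} (hw : D.IsWeight w) :
    D.IsWeight fun y => w (D.q * y) := fun G hG => by
  have hc : ContinuousAt (fun y => G (D.q⁻¹ * y)) 0 := by
    have : ContinuousAt (fun y : ℂ => D.q⁻¹ * y) 0 := by fun_prop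
    exact ContinuousAt.comp (g := G) (by simpa using hG) this
  refine (((hw _ hc).shift hq).const_mul D.q⁻¹).congr fun y _ => ?_
  rw [inv_mul_cancel_left₀ hq, inv_mul_cancel_left₀ hq]

lemma IsWeight.poly {w : ℂ → ℂ} (hw : D.IsWeight w) (r : ℂ[X]) :
    D.Integrable fun y => w y * r.eval y := hw _ r.continuous.continuousAt

/-- Integration of polynomials against a weight. -/
noncomputable def IsWeight.moment {w : ℂ → ℂ} (hw : D.IsWeight w) : ℂ[X] →ₗ[ℂ] ℂ where
  toFun r := D.integral fun y => w y * r.eval y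
  map_add' r s := by
    rw [← integral_add (hw.poly r) (hw.poly s)]
    simp only [eval_add, mul_add]
  map_smul' a r := by
    simp only [eval_smul, smul_eq_mul, mul_left_comm _ a, integral_const_mul, RingHom.id_apply]

lemma IsWeight.moment_apply {w : ℂ → ℂ} (hw : D.IsWeight w) (r : ℂ[X]) :
    hw.moment r = D.integral fun y => w y * r.eval y := rfl

lemma IsWeight.moment_shift (hq : D.q ≠ 0) {w : ℂ → ℂ} (hw : D.IsWeight w) (r : ℂ[X]) :
    D.q * (hw.shift hq).moment (r.comp (C D.q * X)) = hw.moment r := by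
  rw [moment_apply, moment_apply, ← integral_shift hq fun y => w y * r.eval y,
    ← integral_const_mul]
  simp

/-! ### Convergence on terminal lattices -/

lemma tendsto_zpow_atTop {r : ℂ} (hr : ‖r‖ < 1) : Tendsto (fun k : ℤ => r ^ k) atTop (𝓝 0) := by
  have h1 : Tendsto (fun k : ℤ => k.toNat) atTop atTop :=
    tendsto_atTop.2 fun n => (eventually_ge_atTop (n : ℤ)).mono fun k hk => by omega
  refine ((tendsto_pow_atTop_nhds_zero_of_norm_lt_one hr).comp h1).congr' ?_
  filter_upwards [eventually_ge_atTop (0 : ℤ)] with k hk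
  rw [Function.comp_apply, ← zpow_natCast, Int.toNat_of_nonneg hk]

lemma tendsto_zpow_atBot {r : ℂ} (hr : 1 < ‖r‖) : Tendsto (fun k : ℤ => r ^ k) atBot (𝓝 0) := by
  have := (tendsto_zpow_atTop (norm_inv_lt_one hr)).comp tendsto_neg_atBot_atTop
  refine this.congr fun k => ?_
  simp

/-- Geometric decay towards `0` against a bounded factor, and finitely many nonzero terms at the
outer end. -/
lemma summable_zpow_mul {r : ℂ} (hr : ‖r‖ < 1) {F : ℤ → ℂ} {L : ℂ}
    (hF : Tendsto F atTop (𝓝 L)) (h0 : ∀ᶠ k in atBot, F k = 0) :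
    Summable fun k : ℤ => r ^ k * F k := by
  refine Summable.of_nat_of_neg ?_ ?_
  · have h1 : (fun n : ℕ => F n) =O[atTop] fun _ => (1 : ℝ) :=
      (hF.comp tendsto_natCast_atTop_atTop).isBigO_one ℝ
    have h2 : (fun n : ℕ => r ^ (n : ℤ)) =O[atTop] fun n => ‖r‖ ^ n :=
      Asymptotics.isBigO_of_le _ fun n => by simp
    refine summable_of_isBigO_nat (summable_geometric_of_lt_one (norm_nonneg r) hr) ?_
    simpa using h2.mul h1
  · have h1 : Tendsto (fun n : ℕ => -(n : ℤ)) atTop atBot :=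
      tendsto_neg_atTop_atBot.comp tendsto_natCast_atTop_atTop
    refine summable_of_isBigO_nat (g := fun _ => (0 : ℝ)) summable_zero ?_
    refine Asymptotics.IsBigO.of_bound 1 ?_
    filter_upwards [h1.eventually h0] with n hn
    simp [hn]

lemma IsTerminalLattice.summable (hD : D.Nondegenerate) {t c : ℂ} (ht : t ≠ 0)
    (h : D.IsTerminalLattice t c) {G : ℂ → ℂ} (hG : ContinuousAt G 0) :
    Summable fun k : ℤ => D.delta (c * D.q ^ k) * (D.weight t (c * D.q ^ k) * G (c * D.q ^ k)) := by
  have hlim : Tendsto (fun y => D.weight t y * G y) (𝓝 0) (𝓝 (1 * G 0)) :=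
    (tendsto_weight hD t).mul hG
  have e : (fun k : ℤ => D.delta (c * D.q ^ k) * (D.weight t (c * D.q ^ k) * G (c * D.q ^ k))) =
      fun k => (D.q - 1) * c * (D.q ^ k * (D.weight t (c * D.q ^ k) * G (c * D.q ^ k))) := by
    funext k
    rw [delta]
    ring
  rw [e]
  refine Summable.mul_left _ ?_
  rcases h.weight_eq_zero hD ht with ⟨h1, h0⟩ | ⟨h1, h0⟩
  · have : Tendsto (fun k : ℤ => c * D.q ^ k) atTop (𝓝 0) := by
      simpa using (tendsto_zpow_atTop h1).const_mul c
    exact summable_zpow_mul h1 (hlim.comp this) (h0.mono fun k hk => by simp [hk])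
  · have : Tendsto (fun k : ℤ => c * D.q ^ k) atBot (𝓝 0) := by
      simpa using (tendsto_zpow_atBot h1).const_mul c
    rw [← (Equiv.neg ℤ).summable_iff]
    have := summable_zpow_mul (norm_inv_lt_one h1)
      ((hlim.comp this).comp tendsto_neg_atTop_atBot)
      ((tendsto_neg_atBot_atTop.eventually h0).mono fun k hk => by
        simp only [Function.comp_apply, hk, zero_mul])
    refine this.congr fun k => ?_
    simp

lemma isWeight_weight (hD : D.Nondegenerate) {t : ℂ} (ht : t ≠ 0)
    (h0 : D.IsTerminalLattice t D.x0) (h1 : D.IsTerminalLattice t D.x1) :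
    D.IsWeight (D.weight t) := by
  rintro G hG c (rfl | rfl)
  · exact h0.summable hD ht hG
  · exact h1.summable hD ht hG

/-- The point is that `L` and `M` do not depend on the lattice: the weight tends to `1` at `0` and
is eventually `0` outwards. The telescoped sums over the two lattices therefore agree. -/
lemma exists_tendsto_weight_lattice (hD : D.Nondegenerate) {t : ℂ} (ht : t ≠ 0) :
    ∃ L M : ℂ, ∀ c, D.IsTerminalLattice t c →
      Tendsto (fun k : ℤ => D.weight t (c * D.q ^ k)) atTop (𝓝 L) ∧
      Tendsto (fun k : ℤ => D.weight t (c * D.q ^ k)) atBot (𝓝 M) := by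
  have hz : ∀ {l : Filter ℤ} {c : ℂ}, (∀ᶠ k in l, D.weight t (c * D.q ^ k) = 0) →
      Tendsto (fun k : ℤ => D.weight t (c * D.q ^ k)) l (𝓝 0) := fun h =>
    tendsto_const_nhds.congr' (h.mono fun _ hk => hk.symm)
  have hl : ∀ {l : Filter ℤ} (c : ℂ), Tendsto (fun k : ℤ => D.q ^ k) l (𝓝 0) →
      Tendsto (fun k : ℤ => D.weight t (c * D.q ^ k)) l (𝓝 1) := fun c h =>
    (tendsto_weight hD t).comp (by simpa using h.const_mul c)
  rcases hD.norm_q_ne.lt_or_gt with h1 | h1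
  · refine ⟨1, 0, fun c h => ⟨hl c (tendsto_zpow_atTop h1), ?_⟩⟩
    exact hz ((h.weight_eq_zero hD ht).resolve_right fun h' => absurd h'.1 h1.not_gt).2
  · refine ⟨0, 1, fun c h => ⟨?_, hl c (tendsto_zpow_atBot h1)⟩⟩
    exact hz ((h.weight_eq_zero hD ht).resolve_left fun h' => absurd h'.1 h1.not_gt).2

lemma tsum_int_telescope {h : ℤ → ℂ} {L M : ℂ} (hL : Tendsto h atTop (𝓝 L))
    (hM : Tendsto h atBot (𝓝 M)) (hs : Summable fun k => h (k + 1) - h k) :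
    ∑' k, (h (k + 1) - h k) = L - M := by
  have h1 := hs.hasSum.nat_add_neg_add_one.tendsto_sum_nat
  have h2 : Tendsto (fun n : ℕ => h n - h (-n)) atTop (𝓝 (L - M)) :=
    (hL.comp tendsto_natCast_atTop_atTop).sub
      (hM.comp (tendsto_neg_atTop_atBot.comp tendsto_natCast_atTop_atTop))
  refine tendsto_nhds_unique h1 (h2.congr fun n => ?_)
  have := Finset.sum_range_sub (fun n : ℕ => h n - h (-n)) n
  simp only [Nat.cast_zero, neg_zero, sub_self, sub_zero] at this
  rw [← this]
  refine Finset.sum_congr rfl fun i _ => ?_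
  push_cast
  rw [show -((i : ℤ) + 1) + 1 = -i by ring]
  ring

/-- The boundary terms at `0` of the two lattices cancel. -/
lemma integral_weight_shift_sub (hD : D.Nondegenerate) {t : ℂ} (ht : t ≠ 0)
    (h0 : D.IsTerminalLattice t D.x0) (h1 : D.IsTerminalLattice t D.x1)
    (hi : D.Integrable fun y => (D.weight t (D.q * y) - D.weight t y) / y) :
    D.integral (fun y => (D.weight t (D.q * y) - D.weight t y) / y) = 0 := by
  obtain ⟨L, M, hLM⟩ := exists_tendsto_weight_lattice hD ht
  have key : ∀ c, (c = D.x0 ∨ c = D.x1) → D.IsTerminalLattice t c →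
      D.latticeIntegral c (fun y => (D.weight t (D.q * y) - D.weight t y) / y) =
        (D.q - 1) * (L - M) := by
    intro c hc hT
    have hc0 := hT.ne_zero hD ht
    have hq := hD.q_ne
    have e : ∀ k : ℤ, D.delta (c * D.q ^ k) * ((D.weight t (D.q * (c * D.q ^ k)) -
        D.weight t (c * D.q ^ k)) / (c * D.q ^ k)) =
        (D.q - 1) * (D.weight t (c * D.q ^ (k + 1)) - D.weight t (c * D.q ^ k)) := fun k => by
      have h2 : D.q * (c * D.q ^ k) = c * D.q ^ (k + 1) := by rw [zpow_add_one₀ hq]; ring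
      have h3 : D.q ^ k ≠ 0 := zpow_ne_zero _ hq
      rw [h2, delta]
      field_simp
    have hs := hi c hc
    simp only [e] at hs
    rw [summable_mul_left_iff hD.q_sub_one_ne] at hs
    rw [latticeIntegral]
    simp only [e]
    rw [tsum_mul_left, tsum_int_telescope (hLM c hT).1 (hLM c hT).2 hs]
  rw [integral, key _ (Or.inr rfl) h1, key _ (Or.inl rfl) h0, sub_self]

/-! ### Functions of the second kind -/

lemma coeff_divX_iterate (f : ℂ[X]) (j m : ℕ) : (divX^[j] f).coeff m = f.coeff (m + j) := by
  induction j generalizing f with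
  | zero => rfl
  | succ j ih => rw [Function.iterate_succ_apply, ih, coeff_divX]; rfl

lemma natDegree_divX_iterate_le (f : ℂ[X]) (j : ℕ) :
    (divX^[j] f).natDegree ≤ f.natDegree - j := by
  rw [natDegree_le_iff_coeff_eq_zero]
  intro m hm
  rw [coeff_divX_iterate]
  exact coeff_eq_zero_of_natDegree_lt (by omega)

lemma divX_iterate_eq_zero {f : ℂ[X]} {j : ℕ} (h : f.natDegree < j) : divX^[j] f = 0 := by
  ext m
  rw [coeff_divX_iterate, coeff_zero]
  exact coeff_eq_zero_of_natDegree_lt (by omega)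

/-- The divided difference `(f(X) - f(x)) / (X - x)`. -/
noncomputable def divDiff (f : ℂ[X]) (x : ℂ) : ℂ[X] :=
  ∑ i ∈ Finset.range (f.natDegree + 1), x ^ i • divX^[i + 1] f

lemma sub_mul_eval_divDiff (f : ℂ[X]) (x y : ℂ) :
    (y - x) * (divDiff f x).eval y = f.eval y - f.eval x := by
  -- From `divX^[i] f = X * divX^[i+1] f + f_i`: the sum telescopes to `f(y)`, and the remainders
  -- `f_i x^i` add up to `f(x)`.
  have h : ∀ i, (y - x) * (x ^ i * (divX^[i + 1] f).eval y) =
      x ^ i * (divX^[i] f).eval y - x ^ (i + 1) * (divX^[i + 1] f).eval y -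
        f.coeff i * x ^ i := by
    intro i
    have h1 := congrArg (eval y) (divX_mul_X_add (divX^[i] f))
    rw [← Function.iterate_succ_apply' divX, coeff_divX_iterate, zero_add] at h1
    simp only [eval_add, eval_mul, eval_X, eval_C] at h1
    rw [← h1]
    ring
  rw [divDiff, eval_finsetSum, Finset.mul_sum]
  simp only [eval_smul, smul_eq_mul, h]
  rw [Finset.sum_sub_distrib, Finset.sum_range_sub', ← eval_eq_sum_range,
    divX_iterate_eq_zero (Nat.lt_succ_self f.natDegree)]
  simp

/-- The polynomial `x ↦ Λ ((f(X) - f(x)) / (X - x))`. -/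
noncomputable def secondKind (Λ : ℂ[X] →ₗ[ℂ] ℂ) (f : ℂ[X]) : ℂ[X] :=
  ∑ i ∈ Finset.range (f.natDegree + 1), monomial i (Λ (divX^[i + 1] f))

lemma eval_secondKind (Λ : ℂ[X] →ₗ[ℂ] ℂ) (f : ℂ[X]) (x : ℂ) :
    (secondKind Λ f).eval x = Λ (divDiff f x) := by
  simp [secondKind, divDiff, eval_finsetSum, mul_comm]

lemma coeff_secondKind (Λ : ℂ[X] →ₗ[ℂ] ℂ) (f : ℂ[X]) (i : ℕ) :
    (secondKind Λ f).coeff i = Λ (divX^[i + 1] f) := by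
  simp only [secondKind, finsetSum_coeff, coeff_monomial, Finset.sum_ite_eq', Finset.mem_range]
  split_ifs with h
  · rfl
  · rw [divX_iterate_eq_zero (by omega), map_zero]

/-- Write `F(x) = F(y) + (F(x) - F(y))` under the integral. The divided difference contributes a
polynomial in `x`; what remains is the Cauchy transform of `w p F`, the same for both weights by
`h`. -/
lemma integral_cauchy_sub {w₁ w₂ : ℂ → ℂ} (hw₁ : D.IsWeight w₁) (hw₂ : D.IsWeight w₂)
    (p₁ F₁ p₂ F₂ : ℂ[X])
    (h : ∀ y ∈ D.latticePoints, w₁ y * p₁.eval y * F₁.eval y = w₂ y * p₂.eval y * F₂.eval y)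
    {x : ℂ} (hx0 : x ≠ 0) (hx : x ∉ D.latticePoints) :
    F₁.eval x * D.integral (fun y => w₁ y * p₁.eval y / (x - y)) -
      F₂.eval x * D.integral (fun y => w₂ y * p₂.eval y / (x - y)) =
    (secondKind (hw₁.moment ∘ₗ LinearMap.mulLeft ℂ p₁) F₁ -
      secondKind (hw₂.moment ∘ₗ LinearMap.mulLeft ℂ p₂) F₂).eval x := by
  have key : ∀ (w : ℂ → ℂ) (hw : D.IsWeight w) (p F : ℂ[X]),
      (D.Integrable fun y => w y * p.eval y * F.eval y / (x - y)) ∧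
      F.eval x * D.integral (fun y => w y * p.eval y / (x - y)) =
        (secondKind (hw.moment ∘ₗ LinearMap.mulLeft ℂ p) F).eval x +
          D.integral (fun y => w y * p.eval y * F.eval y / (x - y)) := by
    intro w hw p F
    have hi : D.Integrable fun y => w y * p.eval y * F.eval y / (x - y) := by
      have hc : ContinuousAt (fun y => p.eval y * F.eval y / (x - y)) 0 :=
        (p.continuous.continuousAt.mul F.continuous.continuousAt).div
          (continuousAt_const.sub continuousAt_id) (by simpa using hx0)
      refine (hw _ hc).congr fun y _ => ?_
      ring
    refine ⟨hi, ?_⟩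
    rw [eval_secondKind, LinearMap.comp_apply, LinearMap.mulLeft_apply, hw.moment_apply,
      ← integral_add (hw.poly _) hi, ← integral_const_mul]
    refine integral_congr fun y hy => ?_
    have hxy : x - y ≠ 0 := sub_ne_zero.2 fun e => hx (e ▸ hy)
    have := sub_mul_eval_divDiff F x y
    rw [eval_mul]
    field_simp
    linear_combination (w y * p.eval y) * this
  obtain ⟨-, e1⟩ := key w₁ hw₁ p₁ F₁
  obtain ⟨-, e2⟩ := key w₂ hw₂ p₂ F₂
  rw [e1, e2, eval_sub, integral_congr (g := fun y => w₂ y * p₂.eval y * F₂.eval y / (x - y))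
    fun y hy => by rw [h y hy]]
  ring

/-! ### Orthogonality -/

/-- `Λ` annihilates the polynomials of degree less than `n` and takes the value `c` at `X ^ n`. -/
def IsOrthogonal (Λ : ℂ[X] →ₗ[ℂ] ℂ) (n : ℕ) (c : ℂ) : Prop :=
  ∀ r : ℂ[X], r.natDegree ≤ n → Λ r = c * r.coeff n

/-- The `i`-th coefficient is `Λ` applied to `f` shifted down by `i + 1`, which has degree at most
`n`, so only its top coefficient survives. -/
lemma IsOrthogonal.coeff_secondKind {Λ : ℂ[X] →ₗ[ℂ] ℂ} {n : ℕ} {c : ℂ} (h : IsOrthogonal Λ n c)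
    {f : ℂ[X]} {i : ℕ} (hf : f.natDegree ≤ n + i + 1) :
    (secondKind Λ f).coeff i = c * f.coeff (n + i + 1) := by
  rw [QJacobi.coeff_secondKind, h _ ((natDegree_divX_iterate_le _ _).trans (by omega)),
    coeff_divX_iterate, add_assoc]

lemma IsOrthogonal.natDegree_secondKind_le {Λ : ℂ[X] →ₗ[ℂ] ℂ} {n : ℕ} {c : ℂ}
    (h : IsOrthogonal Λ n c) {f : ℂ[X]} {m : ℕ} (hf : f.natDegree ≤ n + m + 1) :
    (secondKind Λ f).natDegree ≤ m := by
  rw [natDegree_le_iff_coeff_eq_zero]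
  intro i hi
  rw [h.coeff_secondKind (by omega), coeff_eq_zero_of_natDegree_lt (by omega), mul_zero]

lemma IsOrthogonal.secondKind_eq_zero {Λ : ℂ[X] →ₗ[ℂ] ℂ} {n : ℕ} {c : ℂ} (h : IsOrthogonal Λ n c)
    {f : ℂ[X]} (hf : f.natDegree ≤ n) : secondKind Λ f = 0 := by
  ext i
  rw [h.coeff_secondKind (by omega), coeff_eq_zero_of_natDegree_lt (by omega), mul_zero, coeff_zero]

lemma IsOPS.ne_zero {t : ℂ} {p : ℕ → ℂ[X]} (hp : D.IsOPS t p) (n : ℕ) : p n ≠ 0 := by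
  intro h
  have := hp.orthonormal n n
  simp [h, integral, latticeIntegral] at this

lemma IsOPS.gam_ne_zero {t : ℂ} {p : ℕ → ℂ[X]} (hp : D.IsOPS t p) (n : ℕ) : gam p n ≠ 0 :=
  leadingCoeff_ne_zero.2 (hp.ne_zero n)

lemma IsOPS.recA_ne_zero {t : ℂ} {p : ℕ → ℂ[X]} (hp : D.IsOPS t p) (n : ℕ) : recA p n ≠ 0 :=
  div_ne_zero (hp.gam_ne_zero _) (hp.gam_ne_zero _)

lemma IsOPS.gam_eq {t : ℂ} {p : ℕ → ℂ[X]} (hp : D.IsOPS t p) (n : ℕ) :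
    gam p n = (p n).coeff n := by
  rw [gam, leadingCoeff, hp.natDegree_eq]

lemma IsOPS.moment_mul {t : ℂ} {p : ℕ → ℂ[X]} (hp : D.IsOPS t p) (hw : D.IsWeight (D.weight t))
    (m n : ℕ) : hw.moment (p m * p n) = if m = n then 1 else 0 := by
  rw [hw.moment_apply, ← hp.orthonormal m n]
  simp only [eval_mul, mul_assoc]

lemma natDegree_sub_C_mul_lt {t : ℂ} {p : ℕ → ℂ[X]} (hp : D.IsOPS t p) {r : ℂ[X]} {n : ℕ}
    (hr : r.natDegree ≤ n) :
    ∀ i, n ≤ i → (r - (r.coeff n / gam p n) • p n).coeff i = 0 := by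
  intro i hi
  rw [coeff_sub, coeff_smul, smul_eq_mul]
  rcases hi.eq_or_lt with rfl | hi
  · rw [← hp.gam_eq, div_mul_cancel₀ _ (hp.gam_ne_zero n), sub_self]
  · rw [coeff_eq_zero_of_natDegree_lt (hr.trans_lt hi),
      coeff_eq_zero_of_natDegree_lt (p := p n) (by rwa [hp.natDegree_eq]), mul_zero, sub_zero]

/-- Induction on the degree bound: subtracting a multiple of `p m` lowers it. No positivity is
available, only the nonvanishing of the leading coefficients. -/
lemma IsOPS.moment_mul_eq_zero {t : ℂ} {p : ℕ → ℂ[X]} (hp : D.IsOPS t p)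
    (hw : D.IsWeight (D.weight t)) {n m : ℕ} (hm : m ≤ n) :
    ∀ r : ℂ[X], (∀ i, m ≤ i → r.coeff i = 0) → hw.moment (p n * r) = 0 := by
  induction m with
  | zero =>
    intro r hr
    have : r = 0 := by ext i; simpa using hr i (Nat.zero_le i)
    simp [this]
  | succ m ih =>
    intro r hr
    have hdeg : r.natDegree ≤ m := natDegree_le_iff_coeff_eq_zero.2 fun i hi => hr i hi
    have h1 := ih (by omega) _ (natDegree_sub_C_mul_lt hp hdeg)
    rw [mul_sub, mul_smul_comm, map_sub, map_smul, hp.moment_mul hw, if_neg (by omega), smul_zero,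
      sub_zero] at h1
    exact h1

lemma IsOPS.isOrthogonal {t : ℂ} {p : ℕ → ℂ[X]} (hp : D.IsOPS t p)
    (hw : D.IsWeight (D.weight t)) (n : ℕ) :
    IsOrthogonal (hw.moment ∘ₗ LinearMap.mulLeft ℂ (p n)) n (gam p n)⁻¹ := by
  intro r hr
  have h1 := hp.moment_mul_eq_zero hw le_rfl _ (natDegree_sub_C_mul_lt hp hr)
  rw [mul_sub, mul_smul_comm, map_sub, map_smul, hp.moment_mul hw, if_pos rfl, smul_eq_mul,
    mul_one, sub_eq_zero] at h1
  rw [LinearMap.comp_apply, LinearMap.mulLeft_apply, h1]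
  ring

/-- Substituting `y ↦ y / q` reduces to the unshifted functional; `q⁻¹` comes from the measure and
`q⁻ⁿ` from the top monomial. -/
lemma IsOPS.isOrthogonal_shift (hq : D.q ≠ 0) {t : ℂ} {p : ℕ → ℂ[X]} (hp : D.IsOPS t p)
    (hw : D.IsWeight (D.weight t)) (n : ℕ) :
    IsOrthogonal ((hw.shift hq).moment ∘ₗ LinearMap.mulLeft ℂ ((p n).comp (C D.q * X))) n
      ((D.q ^ (n + 1))⁻¹ * (gam p n)⁻¹) := by
  intro r hr
  set s : ℂ[X] := r.comp (C D.q⁻¹ * X) with hs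
  have hrs : s.comp (C D.q * X) = r := by
    rw [hs, comp_assoc]
    simp [← mul_assoc, ← C_mul, hq]
  have hsd : s.natDegree ≤ n := by
    rw [hs]
    refine natDegree_comp_le.trans ?_
    exact (Nat.mul_le_mul hr 
      ((natDegree_C_mul_le _ _).trans natDegree_X_le)).trans (mul_one n).le
  have h1 := hp.isOrthogonal hw n s hsd
  rw [LinearMap.comp_apply, LinearMap.mulLeft_apply] at h1 ⊢
  rw [← hw.moment_shift hq, mul_comp, hrs] at h1
  have h2 : s.coeff n = r.coeff n * D.q⁻¹ ^ n := by
    rw [hs, comp_C_mul_X_coeff]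
  rw [h2] at h1
  rw [← mul_right_inj' hq, h1, pow_succ, inv_pow]
  field_simp

/-- The Casoratian of consecutive solutions. -/
lemma IsOPS.casoratian {t : ℂ} {p : ℕ → ℂ[X]} (hp : D.IsOPS t p)
    (hw : D.IsWeight (D.weight t)) {n : ℕ} (hn : 1 ≤ n) {x : ℂ} (hx0 : x ≠ 0)
    (hx : x ∉ D.latticePoints) :
    recA p n * ((p n).eval x * D.assoc t p (n - 1) x - (p (n - 1)).eval x * D.assoc t p n x) = 1 := by
  have h := integral_cauchy_sub hw hw (p (n - 1)) (p n) (p n) (p (n - 1))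
    (fun y _ => by ring) hx0 hx
  obtain ⟨m, rfl⟩ : ∃ m, n = m + 1 := ⟨n - 1, by omega⟩
  simp only [Nat.add_sub_cancel] at h ⊢
  have h1 : secondKind (hw.moment ∘ₗ LinearMap.mulLeft ℂ (p m)) (p (m + 1)) =
      C ((gam p m)⁻¹ * gam p (m + 1)) := by
    have hd := (hp.isOrthogonal hw m).natDegree_secondKind_le (f := p (m + 1)) (m := 0)
      (hp.natDegree_eq _).le
    rw [eq_C_of_natDegree_le_zero hd, (hp.isOrthogonal hw m).coeff_secondKind (i := 0)
      (hp.natDegree_eq _).le, hp.gam_eq (m + 1)]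
  have h2 : secondKind (hw.moment ∘ₗ LinearMap.mulLeft ℂ (p (m + 1))) (p m) = 0 :=
    (hp.isOrthogonal hw (m + 1)).secondKind_eq_zero ((hp.natDegree_eq _).trans_le (by omega))
  rw [h1, h2, sub_zero, eval_C] at h
  rw [assoc, assoc, h, recA, Nat.add_sub_cancel]
  have g1 := hp.gam_ne_zero m
  have g2 := hp.gam_ne_zero (m + 1)
  field_simp

/-! ### Transfer matrices -/

/-- An orthonormal system at a regular time `t`, on lattices that carry the weight. -/
structure IsSystem (D : QJacobi) (t : ℂ) (p : ℕ → ℂ[X]) : Prop where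
  nondegenerate : D.Nondegenerate
  t_ne : t ≠ 0
  regular : D.Regular t
  terminal_x0 : D.IsTerminalLattice t D.x0
  terminal_x1 : D.IsTerminalLattice t D.x1
  isOPS : D.IsOPS t p

lemma IsSystem.isWeight {t : ℂ} {p : ℕ → ℂ[X]} (h : D.IsSystem t p) : D.IsWeight (D.weight t) :=
  isWeight_weight h.nondegenerate h.t_ne h.terminal_x0 h.terminal_x1

lemma IsSystem.offPoles {t : ℂ} {p : ℕ → ℂ[X]} (h : D.IsSystem t p) {y : ℂ}
    (hy : y ∈ D.latticePoints) : D.OffPoles t y := by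
  obtain ⟨c, rfl | rfl, k, rfl⟩ := hy
  · exact h.terminal_x0.offPoles h.nondegenerate h.regular k
  · exact h.terminal_x1.offPoles h.nondegenerate h.regular k

lemma IsSystem.ne_zero_of_mem {t : ℂ} {p : ℕ → ℂ[X]} (h : D.IsSystem t p) {y : ℂ}
    (hy : y ∈ D.latticePoints) : y ≠ 0 := by
  have hk : ∀ k : ℤ, D.q ^ k ≠ 0 := fun k => zpow_ne_zero k h.nondegenerate.q_ne
  obtain ⟨c, rfl | rfl, k, rfl⟩ := hy
  · exact mul_ne_zero (h.terminal_x0.ne_zero h.nondegenerate h.t_ne) (hk k)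
  · exact mul_ne_zero (h.terminal_x1.ne_zero h.nondegenerate h.t_ne) (hk k)

lemma IsSystem.notMem_latticePoints {t : ℂ} {p : ℕ → ℂ[X]} (h : D.IsSystem t p) {x : ℂ}
    (hx : D.Admissible t x) : x ∉ D.latticePoints := by
  have hq := h.nondegenerate.q_ne
  have key : ∀ c, D.IsTerminalLattice t c → ∀ k : ℤ, x ≠ c * D.q ^ k := by
    rintro c ⟨m, hc⟩ k hk
    refine hx.2 (c * D.q ^ m) ?_ (k - m) ?_
    · rcases hc with ⟨-, hc | hc | hc⟩ | ⟨-, hc | hc | hc⟩ <;> simp [hc]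
    · rw [hk, mul_assoc, ← zpow_add₀ hq]
      congr 2
      ring
  rintro ⟨c, rfl | rfl, k, hk⟩
  · exact key _ h.terminal_x0 k hk
  · exact key _ h.terminal_x1 k hk

/-- The polynomial `Λ₁ ((α u)(x)) - Λ₂ ((β r)(x))` of functions of the second kind. -/
noncomputable def crossPoly {w₁ w₂ : ℂ → ℂ} (hw₁ : D.IsWeight w₁) (hw₂ : D.IsWeight w₂)
    (α β r u : ℂ[X]) : ℂ[X] :=
  secondKind (hw₁.moment ∘ₗ LinearMap.mulLeft ℂ r) (α * u) -
    secondKind (hw₂.moment ∘ₗ LinearMap.mulLeft ℂ u) (β * r)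

lemma eval_crossPoly {w₁ w₂ : ℂ → ℂ} (hw₁ : D.IsWeight w₁) (hw₂ : D.IsWeight w₂)
    {α β : ℂ[X]} (h : ∀ y ∈ D.latticePoints, α.eval y * w₁ y = β.eval y * w₂ y) (r u : ℂ[X])
    {x : ℂ} (hx0 : x ≠ 0) (hx : x ∉ D.latticePoints) :
    (crossPoly hw₁ hw₂ α β r u).eval x =
      α.eval x * u.eval x * D.integral (fun y => w₁ y * r.eval y / (x - y)) -
        β.eval x * r.eval x * D.integral (fun y => w₂ y * u.eval y / (x - y)) := by
  rw [crossPoly, ← integral_cauchy_sub hw₁ hw₂ r (α * u) u (β * r) _ hx0 hx, eval_mul, eval_mul]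
  intro y hy
  rw [eval_mul, eval_mul]
  linear_combination (r.eval y * u.eval y) * h y hy

/-- The polynomial matrix `M` with `α Y' = M Y`, where `Y'` is built from the polynomials
`u₁, u₀` and the weight `w₂`. -/
noncomputable def transferMatrix {w₁ w₂ : ℂ → ℂ} (hw₁ : D.IsWeight w₁) (hw₂ : D.IsWeight w₂)
    (α β : ℂ[X]) (p : ℕ → ℂ[X]) (n : ℕ) (u₁ u₀ : ℂ[X]) : Matrix (Fin 2) (Fin 2) ℂ[X] :=
  !![C (recA p n) * crossPoly hw₁ hw₂ α β (p (n - 1)) u₁,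
      -(C (recA p n) * crossPoly hw₁ hw₂ α β (p n) u₁);
     C (recA p n) * crossPoly hw₁ hw₂ α β (p (n - 1)) u₀,
      -(C (recA p n) * crossPoly hw₁ hw₂ α β (p n) u₀)]

/-- Cramer's rule for `α Y' Y⁻¹`: the determinant is the Casoratian, and the minors are the
expressions evaluated in `eval_crossPoly`. -/
lemma IsSystem.transferMatrix_mul {t : ℂ} {P : ℂ → ℕ → ℂ[X]} (h : D.IsSystem t (P t)) {n : ℕ}
    (hn : 1 ≤ n) {w₂ : ℂ → ℂ} (hw₂ : D.IsWeight w₂) {α β : ℂ[X]}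
    (hαβ : ∀ y ∈ D.latticePoints, α.eval y * D.weight t y = β.eval y * w₂ y) (u₁ u₀ : ℂ[X])
    {x : ℂ} (hx : D.Admissible t x) (hx₂ : w₂ x ≠ 0)
    (hx' : α.eval x * D.weight t x = β.eval x * w₂ x) :
    α.eval x • !![u₁.eval x, D.integral (fun y => w₂ y * u₁.eval y / (x - y)) / w₂ x;
      u₀.eval x, D.integral (fun y => w₂ y * u₀.eval y / (x - y)) / w₂ x] =
    (transferMatrix h.isWeight hw₂ α β (P t) n u₁ u₀).map (fun r => r.eval x) * D.Y P n t x := by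
  have hw := hx.weight_ne_zero h.nondegenerate h.t_ne
  have hc := h.isOPS.casoratian h.isWeight hn hx.1 (h.notMem_latticePoints hx)
  have he : ∀ r u, (crossPoly h.isWeight hw₂ α β r u).eval x = _ := fun r u =>
    eval_crossPoly h.isWeight hw₂ hαβ r u hx.1 (h.notMem_latticePoints hx)
  rw [assoc, assoc] at hc
  ext i j
  fin_cases i <;> fin_cases j <;>
    simp only [transferMatrix, Y, assoc, he, Matrix.mul_apply, Fin.sum_univ_two, Matrix.map_apply,
      Matrix.smul_apply, smul_eq_mul, eval_neg, eval_mul, eval_C, Matrix.of_apply, Matrix.cons_val',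
      Matrix.cons_val_zero, Matrix.cons_val_one, Matrix.cons_val_fin_one, Fin.zero_eta, Fin.mk_one,
      Fin.isValue]
  · linear_combination (-(α.eval x * u₁.eval x)) * hc
  · field_simp
    linear_combination (D.integral (fun y => w₂ y * u₁.eval y / (x - y))) * hx' -
      (w₂ x * β.eval x * D.integral (fun y => w₂ y * u₁.eval y / (x - y))) * hc
  · linear_combination (-(α.eval x * u₀.eval x)) * hc
  · field_simp
    linear_combination (D.integral (fun y => w₂ y * u₀.eval y / (x - y))) * hx' -
      (w₂ x * β.eval x * D.integral (fun y => w₂ y * u₀.eval y / (x - y))) * hc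

lemma IsSystem.det_Y {t : ℂ} {P : ℂ → ℕ → ℂ[X]} (h : D.IsSystem t (P t)) {n : ℕ}
    (hn : 1 ≤ n) {x : ℂ} (hx : D.Admissible t x) :
    recA (P t) n * D.weight t x * (D.Y P n t x).det = 1 := by
  have hw := hx.weight_ne_zero h.nondegenerate h.t_ne
  have hc := h.isOPS.casoratian h.isWeight hn hx.1 (h.notMem_latticePoints hx)
  rw [Y, Matrix.det_fin_two_of, ← hc]
  field_simp

lemma IsSystem.det_Y_ne_zero {t : ℂ} {P : ℂ → ℕ → ℂ[X]} (h : D.IsSystem t (P t)) {n : ℕ}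
    (hn : 1 ≤ n) {x : ℂ} (hx : D.Admissible t x) : (D.Y P n t x).det ≠ 0 := by
  intro h0
  simpa [h0] using h.det_Y hn hx

/-! ### The spectral matrix -/

/-- `W + Δy V` as a polynomial. -/
noncomputable def specPlusPoly (D : QJacobi) (t : ℂ) : ℂ[X] :=
  C D.b6 * (1 - C D.b1 * X) * (1 - C D.b4 * X) * (C t - C D.b6 * X)

/-- `W - Δy V` as a polynomial. -/
noncomputable def specMinusPoly (D : QJacobi) (t : ℂ) : ℂ[X] :=
  (1 - C D.b2 * X) * (1 - C D.b3 * X) * (C (D.b6 * t) - X)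

lemma eval_specPlusPoly (t x : ℂ) : (D.specPlusPoly t).eval x = D.specPlus t x := by
  simp [specPlusPoly, specPlus]

lemma eval_specMinusPoly (t x : ℂ) : (D.specMinusPoly t).eval x = D.specMinus t x := by
  simp [specMinusPoly, specMinus]

lemma natDegree_specPlusPoly_le (t : ℂ) : (D.specPlusPoly t).natDegree ≤ 3 := by
  rw [specPlusPoly]; compute_degree

lemma natDegree_specMinusPoly_le (t : ℂ) : (D.specMinusPoly t).natDegree ≤ 3 := by
  rw [specMinusPoly]; compute_degree

lemma coeff_three_specPlusPoly (t : ℂ) :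
    (D.specPlusPoly t).coeff 3 = -(D.b1 * D.b4 * D.b6 ^ 2) := by
  have : D.specPlusPoly t = C (-(D.b1 * D.b4 * D.b6 ^ 2)) * X ^ 3 +
      C (D.b6 * (D.b1 * D.b4 * t + (D.b1 + D.b4) * D.b6)) * X ^ 2 +
      C (-(D.b6 * ((D.b1 + D.b4) * t + D.b6))) * X + C (D.b6 * t) := by
    simp only [specPlusPoly, map_mul, map_add, map_neg, map_pow]; ring
  rw [this]
  simp only [coeff_add, coeff_C_mul_X_pow, coeff_C_mul_X, coeff_C]
  norm_num

lemma coeff_three_specMinusPoly (t : ℂ) : (D.specMinusPoly t).coeff 3 = -(D.b2 * D.b3) := by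
  have : D.specMinusPoly t = C (-(D.b2 * D.b3)) * X ^ 3 +
      C (D.b2 * D.b3 * (D.b6 * t) + (D.b2 + D.b3)) * X ^ 2 +
      C (-((D.b2 + D.b3) * (D.b6 * t) + 1)) * X + C (D.b6 * t) := by
    simp only [specMinusPoly, map_mul, map_add, map_neg, map_one]; ring
  rw [this]
  simp only [coeff_add, coeff_C_mul_X_pow, coeff_C_mul_X, coeff_C]
  norm_num

lemma natDegree_comp_C_mul_X_le (p : ℂ[X]) (a : ℂ) : (p.comp (C a * X)).natDegree ≤ p.natDegree :=
  natDegree_comp_le.trans ((Nat.mul_le_mul le_rfl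
    ((natDegree_C_mul_le _ _).trans natDegree_X_le)).trans (mul_one _).le)

lemma eval_eq_mul_divX (p : ℂ[X]) (y : ℂ) : p.eval y = y * p.divX.eval y + p.eval 0 := by
  conv_lhs => rw [← divX_mul_X_add p]
  simp [coeff_zero_eq_eval_zero, mul_comm]

/-- Both spectral polynomials equal `b₆ t` at `0`, so the equation of the weight divides by `y` and
the apparent pole at `0` becomes polynomials integrated against `w(y)` and `w(qy)`. -/
lemma IsSystem.integrable_weight_shift_sub {t : ℂ} {p : ℕ → ℂ[X]} (h : D.IsSystem t p) :
    D.Integrable fun y => (D.weight t (D.q * y) - D.weight t y) / y := by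
  have hq := h.nondegenerate.q_ne
  have hb6 := h.nondegenerate.b6_ne
  have ht := h.t_ne
  refine (((h.isWeight.poly (D.specPlusPoly t).divX).sub
    ((h.isWeight.shift hq).poly (D.specMinusPoly t).divX)).const_mul (D.b6 * t)⁻¹).congr
    fun y hy => ?_
  have hy0 := h.ne_zero_of_mem hy
  have hw := (h.offPoles hy).weight_mul h.nondegenerate ht
  have e1 := eval_eq_mul_divX (D.specPlusPoly t) y
  have e2 := eval_eq_mul_divX (D.specMinusPoly t) y
  rw [eval_specPlusPoly, eval_specPlusPoly] at e1
  rw [eval_specMinusPoly, eval_specMinusPoly] at e2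
  have s1 : D.specPlus t 0 = D.b6 * t := by simp [specPlus]
  have s2 : D.specMinus t 0 = D.b6 * t := by simp [specMinus]
  rw [e1, e2, s1, s2] at hw
  field_simp
  linear_combination -hw

/-- The value at `0` of the entries of the spectral matrix. -/
lemma IsSystem.coeff_zero_crossPoly {t : ℂ} {p : ℕ → ℂ[X]} (h : D.IsSystem t p) (u r : ℂ[X]) :
    (crossPoly h.isWeight (h.isWeight.shift h.nondegenerate.q_ne) (D.specPlusPoly t)
      (D.specMinusPoly t) r (u.comp (C D.q * X))).coeff 0 =
    D.b6 * t * (h.isWeight.moment (r * u.divX) - h.isWeight.moment (u * r.divX)) := by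
  have hq := h.nondegenerate.q_ne
  have hw := h.isWeight
  have hsp : (D.specPlusPoly t).eval 0 = D.b6 * t := by simp [eval_specPlusPoly, specPlus]
  have hsm : (D.specMinusPoly t).eval 0 = D.b6 * t := by simp [eval_specMinusPoly, specMinus]
  have hru : r * u.divX - u * r.divX = r.eval 0 • u.divX - u.eval 0 • r.divX := by
    have h1 := X_mul_divX_add r
    have h2 := X_mul_divX_add u
    rw [coeff_zero_eq_eval_zero] at h1 h2
    rw [smul_eq_C_mul, smul_eq_C_mul]
    linear_combination r.divX * h2 - u.divX * h1
  have hi := h.integrable_weight_shift_sub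
  rw [crossPoly, coeff_sub, coeff_secondKind, coeff_secondKind, ← map_sub, hru]
  simp only [zero_add, Function.iterate_one, LinearMap.comp_apply, LinearMap.mulLeft_apply,
    map_sub, map_smul, smul_eq_mul]
  have e1 : h.isWeight.moment u.divX =
      D.integral fun y => D.q * (D.weight t (D.q * y) * u.divX.eval (D.q * y)) :=
    (integral_shift hq fun y => D.weight t y * u.divX.eval y).symm
  have i1 := (hw.poly u.divX).shift hq
  have e2 := integral_weight_shift_sub h.nondegenerate h.t_ne h.terminal_x0 h.terminal_x1 hi
  rw [IsWeight.moment_apply, IsWeight.moment_apply, IsWeight.moment_apply _ r.divX, e1,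
    ← integral_sub (hw.poly _) ((hw.shift hq).poly _)]
  -- The products containing both spectral data and values at `y` cancel by the equation of the
  -- weight. The rest is split by `u = u(0) + X * divX u` and likewise for `r`, leaving a multiple
  -- of `(w(qy) - w(y)) / y`, whose integral is zero.
  trans D.integral fun y => D.b6 * t * (r.eval 0 * (D.q * (D.weight t (D.q * y) *
    u.divX.eval (D.q * y))) - u.eval 0 * (D.weight t y * r.divX.eval y)) +
      D.b6 * t * r.eval 0 * u.eval 0 * ((D.weight t (D.q * y) - D.weight t y) / y)
  swap
  · have i2 := (i1.const_mul (r.eval 0)).sub ((hw.poly r.divX).const_mul (u.eval 0))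
    rw [integral_add (i2.const_mul _) (hi.const_mul _), integral_const_mul, integral_const_mul, e2,
      integral_sub (i1.const_mul _) ((hw.poly r.divX).const_mul _),
      integral_const_mul _ (r.eval 0), integral_const_mul _ (u.eval 0), mul_zero, add_zero]
  refine integral_congr fun y hy => ?_
  have hy0 := h.ne_zero_of_mem hy
  have hp := (h.offPoles hy).weight_mul h.nondegenerate h.t_ne
  have f1 := eval_eq_mul_divX (D.specPlusPoly t * u.comp (C D.q * X)) y
  have f2 := eval_eq_mul_divX (D.specMinusPoly t * r) y
  have f3 := eval_eq_mul_divX u (D.q * y)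
  have f4 := eval_eq_mul_divX r y
  simp only [eval_mul, eval_comp, eval_C, eval_X, mul_zero, hsp, hsm] at f1 f2
  rw [eval_specPlusPoly] at f1
  rw [eval_specMinusPoly] at f2
  simp only [eval_mul, eval_comp, eval_C, eval_X]
  field_simp
  linear_combination (-(D.weight t y * r.eval y)) * f1 + (D.weight t (D.q * y) * u.eval (D.q * y)) * f2
    - (r.eval y * u.eval (D.q * y)) * hp
    + (D.b6 * t * r.eval 0 * D.weight t (D.q * y)) * f3
    - (D.b6 * t * u.eval 0 * D.weight t y) * f4

/-- The shape of the polynomial spectral matrix. -/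
structure IsSpecPoly (D : QJacobi) (P : ℂ → ℕ → ℂ[X]) (n : ℕ) (t : ℂ)
    (A : Matrix (Fin 2) (Fin 2) ℂ[X]) : Prop where
  smul_Y : ∀ x, D.Admissible t x →
    D.specPlus t x • D.Y P n t (D.q * x) = A.map (fun r => r.eval x) * D.Y P n t x
  natDegree₀₀ : (A 0 0).natDegree ≤ 3
  natDegree₀₁ : (A 0 1).natDegree ≤ 2
  natDegree₁₀ : (A 1 0).natDegree ≤ 2
  natDegree₁₁ : (A 1 1).natDegree ≤ 3
  coeff₀₀ : (A 0 0).coeff 3 = -(D.b5 n * D.b6)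
  coeff₀₁ : (A 0 1).coeff 2 = recA (P t) n * D.b6 * (D.b5 n - (D.q * D.b5 n)⁻¹)
  coeff₁₁ : (A 1 1).coeff 3 = -(D.b6 / D.b5 n)
  coeff_zero₀₀ : (A 0 0).coeff 0 = D.b6 * t
  coeff_zero₀₁ : (A 0 1).coeff 0 = 0
  coeff_zero₁₀ : (A 1 0).coeff 0 = 0
  coeff_zero₁₁ : (A 1 1).coeff 0 = D.b6 * t

lemma Admissible.q_mul (hD : D.Nondegenerate) {t x : ℂ} (h : D.Admissible t x) :
    D.Admissible t (D.q * x) := by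
  have hq := hD.q_ne
  refine ⟨mul_ne_zero hq h.1, fun c hc k hk => h.2 c hc (k - 1) ?_⟩
  rw [zpow_sub_one₀ hq]
  field_simp
  linear_combination hk

lemma b5_ne_zero (hD : D.Nondegenerate) (n : ℕ) : D.b5 n ≠ 0 :=
  mul_ne_zero (pow_ne_zero _ hD.q_ne) (mul_ne_zero (mul_ne_zero hD.b1_ne hD.b4_ne) hD.b6_ne)

lemma integral_shift_assoc (hq : D.q ≠ 0) (t : ℂ) (p : ℕ → ℂ[X]) (n : ℕ) (x : ℂ) :
    D.integral (fun y => D.weight t (D.q * y) * ((p n).comp (C D.q * X)).eval y / (x - y)) =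
      D.assoc t p n (D.q * x) := by
  rw [assoc, ← integral_shift hq fun y => D.weight t y * (p n).eval y / (D.q * x - y)]
  congr 1
  funext y
  rw [← mul_sub, ← mul_div_assoc, mul_div_mul_left _ _ hq]
  simp

lemma natDegree_mul_le_add {p r : ℂ[X]} {a b c : ℕ} (hp : p.natDegree ≤ a) (hr : r.natDegree ≤ b)
    (hc : a + b ≤ c) : (p * r).natDegree ≤ c :=
  natDegree_mul_le.trans (by omega)

/-- The transfer matrix for `w₂(y) = w(qy)` and the polynomials `p_k(q·)`. The factor `q^n` in the
leading coefficient of `p_n(q·)` produces `b₅`, and `b₁b₂b₃b₄ = 1` converts `b₂b₃` into `1 /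
(b₁b₄)`. -/
lemma IsSystem.exists_isSpecPoly {t : ℂ} {P : ℂ → ℕ → ℂ[X]} (h : D.IsSystem t (P t)) {n : ℕ}
    (hn : 1 ≤ n) : ∃ A, D.IsSpecPoly P n t A := by
  have hD := h.nondegenerate
  have hq := hD.q_ne
  have hb6 := hD.b6_ne
  have hb1 := hD.b1_ne
  have hb4 := hD.b4_ne
  have hw := h.isWeight
  have hp := h.isOPS
  have hprod := hD.prod_eq
  obtain ⟨m, rfl⟩ : ∃ m, n = m + 1 := ⟨n - 1, by omega⟩
  set p := P t with hpdef
  have g0 := hp.gam_ne_zero m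
  have g1 := hp.gam_ne_zero (m + 1)
  have ra : recA p (m + 1) = gam p m / gam p (m + 1) := rfl
  set u : ℕ → ℂ[X] := fun k => (p k).comp (C D.q * X) with hu
  have du : ∀ k, (u k).natDegree ≤ k := fun k =>
    (natDegree_comp_C_mul_X_le _ _).trans (hp.natDegree_eq k).le
  have dp : ∀ k, (p k).natDegree ≤ k := fun k => (hp.natDegree_eq k).le
  have cu : ∀ k, (D.specPlusPoly t * u k).coeff (3 + k) =
      -(D.b1 * D.b4 * D.b6 ^ 2) * (gam p k * D.q ^ k) := fun k => by
    rw [coeff_mul_add_eq_of_natDegree_le (natDegree_specPlusPoly_le t) (du k),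
      coeff_three_specPlusPoly, hu, comp_C_mul_X_coeff, hp.gam_eq]
  have cp : ∀ k, (D.specMinusPoly t * p k).coeff (3 + k) = -(D.b2 * D.b3) * gam p k := fun k => by
    rw [coeff_mul_add_eq_of_natDegree_le (natDegree_specMinusPoly_le t) (dp k),
      coeff_three_specMinusPoly, hp.gam_eq]
  have o1 := fun k => hp.isOrthogonal hw k
  have o2 := fun k => hp.isOrthogonal_shift hq hw k
  have dαu : ∀ k l, k + 3 ≤ l → (D.specPlusPoly t * u k).natDegree ≤ l := fun k l hl =>
    natDegree_mul_le_add (natDegree_specPlusPoly_le t) (du k) (by omega)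
  have dβp : ∀ k l, k + 3 ≤ l → (D.specMinusPoly t * p k).natDegree ≤ l := fun k l hl =>
    natDegree_mul_le_add (natDegree_specMinusPoly_le t) (dp k) (by omega)
  have c0 : ∀ r k, (crossPoly hw (hw.shift hq) (D.specPlusPoly t) (D.specMinusPoly t) r
      (u k)).coeff 0 = _ := fun r k => h.coeff_zero_crossPoly (p k) r
  -- These two pairings make the values at `0` explicit: the first is `1 / a_n`, which gives the
  -- diagonal entries `b₆ t`, and equal indices give `0` by antisymmetry.
  have m1 : hw.moment (p m * (p (m + 1)).divX) = gam p (m + 1) / gam p m := by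
    have := o1 m (p (m + 1)).divX (by
      rw [natDegree_divX_eq_natDegree_tsub_one, hp.natDegree_eq]; simp)
    rw [LinearMap.comp_apply, LinearMap.mulLeft_apply, coeff_divX, ← hp.gam_eq] at this
    rw [this]
    field_simp
  have m2 : hw.moment (p (m + 1) * (p m).divX) = 0 := by
    have := o1 (m + 1) (p m).divX (natDegree_divX_le.trans ((dp m).trans (by omega)))
    rw [LinearMap.comp_apply, LinearMap.mulLeft_apply, coeff_divX,
      coeff_eq_zero_of_natDegree_lt ((dp m).trans_lt (by omega)), mul_zero] at this
    exact this
  refine ⟨transferMatrix hw (hw.shift hq) (D.specPlusPoly t) (D.specMinusPoly t) p (m + 1)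
    (u (m + 1)) (u m), ?_, ?_, ?_, ?_, ?_, ?_, ?_, ?_, ?_, ?_, ?_, ?_⟩
  · intro x hx
    have hx2 := (hx.q_mul hD).weight_ne_zero hD h.t_ne
    have := h.transferMatrix_mul (n := m + 1) (by omega) (hw.shift hq) (α := D.specPlusPoly t)
      (β := D.specMinusPoly t) (fun y hy => by
        rw [eval_specPlusPoly, eval_specMinusPoly, (h.offPoles hy).weight_mul hD h.t_ne])
      (u (m + 1)) (u m) hx hx2 (by
        rw [eval_specPlusPoly, eval_specMinusPoly, (hx.offPoles hD).weight_mul hD h.t_ne])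
    rw [← this, eval_specPlusPoly, integral_shift_assoc hq, integral_shift_assoc hq, Y, hu]
    simp [hpdef]
  all_goals
    simp only [transferMatrix, Matrix.of_apply, Matrix.cons_val', Matrix.cons_val_zero,
      Matrix.cons_val_one, Matrix.cons_val_fin_one, Nat.add_sub_cancel, natDegree_neg, coeff_neg,
      coeff_C_mul, c0, m1, m2, sub_self, mul_zero, neg_zero, sub_zero, zero_sub]
  · refine (natDegree_C_mul_le _ _).trans ((natDegree_sub_le _ _).trans (max_le ?_ ?_))
    · exact (o1 m).natDegree_secondKind_le (dαu _ _ (by omega))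
    · exact (o2 (m + 1)).natDegree_secondKind_le (dβp _ _ (by omega))
  · refine (natDegree_C_mul_le _ _).trans ((natDegree_sub_le _ _).trans (max_le ?_ ?_))
    · exact (o1 (m + 1)).natDegree_secondKind_le (dαu _ _ (by omega))
    · exact (o2 (m + 1)).natDegree_secondKind_le (dβp _ _ (by omega))
  · refine (natDegree_C_mul_le _ _).trans ((natDegree_sub_le _ _).trans (max_le ?_ ?_))
    · exact (o1 m).natDegree_secondKind_le (dαu _ _ (by omega))
    · exact (o2 m).natDegree_secondKind_le (dβp _ _ (by omega))
  · refine (natDegree_C_mul_le _ _).trans ((natDegree_sub_le _ _).trans (max_le ?_ ?_))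
    · exact (o1 (m + 1)).natDegree_secondKind_le (dαu _ _ (by omega))
    · exact (o2 m).natDegree_secondKind_le (dβp _ _ (by omega))
  · rw [crossPoly, coeff_sub, (o1 m).coeff_secondKind (dαu _ _ (by omega)),
      (o2 (m + 1)).coeff_secondKind (dβp _ _ (by omega)),
      coeff_eq_zero_of_natDegree_lt (p := D.specMinusPoly t * p m)
        ((dβp m (m + 3) le_rfl).trans_lt (by omega)),
      show m + 3 + 1 = 3 + (m + 1) by ring, cu, ra, b5]
    field_simp
    ring
  · rw [crossPoly, coeff_sub, (o1 (m + 1)).coeff_secondKind (dαu _ _ (by omega)),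
      (o2 (m + 1)).coeff_secondKind (dβp _ _ (by omega)),
      show m + 1 + 2 + 1 = 3 + (m + 1) by ring, cu, cp, ra, b5]
    field_simp
    linear_combination (-(D.q ^ 2 * D.q ^ m)) * hprod
  · rw [crossPoly, coeff_sub, (o1 (m + 1)).coeff_secondKind (dαu _ _ (by omega)),
      (o2 m).coeff_secondKind (dβp _ _ (by omega)),
      coeff_eq_zero_of_natDegree_lt (p := D.specPlusPoly t * u m)
        ((dαu m (m + 3) le_rfl).trans_lt (by omega)),
      show m + 3 + 1 = 3 + (m + 1) by ring, cp, ra, b5]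
    field_simp
    linear_combination (-gam p (m + 1) ^ 2) * hprod
  · rw [ra]
    field_simp
  · rw [ra]
    field_simp

/-! ### The deformation matrix -/

/-- `R + Δu S` as a polynomial. -/
noncomputable def defPlusPoly (D : QJacobi) (t : ℂ) : ℂ[X] :=
  C (-D.b6⁻¹) * X + C (D.b6⁻¹ * (D.b6 * D.q * t))

/-- `R - Δu S` as a polynomial. -/
noncomputable def defMinusPoly (D : QJacobi) (t : ℂ) : ℂ[X] :=
  C (-D.b6) * X + C (D.q * t)

lemma eval_defPlusPoly (t x : ℂ) : (D.defPlusPoly t).eval x = D.defPlus t x := by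
  simp [defPlusPoly, defPlus]; ring

lemma eval_defMinusPoly (t x : ℂ) : (D.defMinusPoly t).eval x = D.defMinus t x := by
  simp [defMinusPoly, defMinus]; ring

lemma coeff_one_defPlusPoly (t : ℂ) : (D.defPlusPoly t).coeff 1 = -D.b6⁻¹ := by
  rw [defPlusPoly, coeff_add, coeff_C_mul_X, coeff_C]; simp

lemma coeff_one_defMinusPoly (t : ℂ) : (D.defMinusPoly t).coeff 1 = -D.b6 := by
  rw [defMinusPoly, coeff_add, coeff_C_mul_X, coeff_C]; simp

lemma Admissible.time_q_mul (hD : D.Nondegenerate) {t x : ℂ} (h : D.Admissible t x) :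
    D.Admissible (D.q * t) x := by
  refine ⟨h.1, ?_⟩
  rintro c (rfl | rfl | rfl | rfl | rfl | rfl) k
  · exact h.2 _ (by simp) k
  · exact h.2 _ (by simp) k
  · exact h.2 _ (by simp) k
  · exact h.2 _ (by simp) k
  · intro hk
    refine h.2 (D.b6 * t) (by simp) (k + 1) ?_
    rw [hk, zpow_add_one₀ hD.q_ne]
    ring
  · intro hk
    refine h.2 (t / D.b6) (by simp) (k + 1) ?_
    rw [hk, zpow_add_one₀ hD.q_ne]
    ring

/-- The polynomial deformation matrix; only the constant terms `r₊`, `r₋` are not explicit. -/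
noncomputable def defPoly (D : QJacobi) (P : ℂ → ℕ → ℂ[X]) (n : ℕ) (t rp rm x : ℂ) :
    Matrix (Fin 2) (Fin 2) ℂ :=
  !![gam (P (D.q * t)) n / (D.b6 * gam (P t) n) * (x + rp),
      -(recA (P t) n * (gam (P (D.q * t)) n / (D.b6 * gam (P t) n) -
        D.b6 * gam (P t) n / gam (P (D.q * t)) n));
     recA (P t) n * (gam (P (D.q * t)) (n - 1) / (D.b6 * gam (P t) (n - 1)) -
        D.b6 * gam (P t) (n - 1) / gam (P (D.q * t)) (n - 1)),
      D.b6 * gam (P t) (n - 1) / gam (P (D.q * t)) (n - 1) * (x + rm)]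

lemma eval_of_natDegree_le_one {r : ℂ[X]} (h : r.natDegree ≤ 1) (x : ℂ) :
    r.eval x = r.coeff 1 * x + r.coeff 0 := by
  conv_lhs => rw [eq_X_add_C_of_natDegree_le_one h]
  simp

lemma eval_of_natDegree_le_zero {r : ℂ[X]} (h : r.natDegree ≤ 0) (x : ℂ) :
    r.eval x = r.coeff 0 := by
  conv_lhs => rw [eq_C_of_natDegree_le_zero h]
  simp

/-- The transfer matrix from time `t` to `qt`. The deformation data are linear, so orthogonality
leaves linear diagonal and constant off-diagonal entries, with only the diagonal constant terms
undetermined. -/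
lemma IsSystem.exists_defPoly {t : ℂ} {P : ℂ → ℕ → ℂ[X]} (h : D.IsSystem t (P t))
    (h' : D.IsSystem (D.q * t) (P (D.q * t))) {n : ℕ} (hn : 1 ≤ n) :
    ∃ rp rm, ∀ x, D.Admissible t x →
      (-(D.defPlus t x)) • D.Y P n (D.q * t) x = D.defPoly P n t rp rm x * D.Y P n t x := by
  have hD := h.nondegenerate
  have hb6 := hD.b6_ne
  have hw := h.isWeight
  have hw' := h'.isWeight
  have hp := h.isOPS
  have hp' := h'.isOPS
  obtain ⟨m, rfl⟩ : ∃ m, n = m + 1 := ⟨n - 1, by omega⟩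
  set p := P t with hpdef
  set u := P (D.q * t) with hudef
  have g0 := hp.gam_ne_zero m
  have g1 := hp.gam_ne_zero (m + 1)
  have g0' := hp'.gam_ne_zero m
  have g1' := hp'.gam_ne_zero (m + 1)
  have ra : recA p (m + 1) = gam p m / gam p (m + 1) := rfl
  have d1 : (D.defPlusPoly t).natDegree ≤ 1 := natDegree_linear_le
  have d2 : (D.defMinusPoly t).natDegree ≤ 1 := natDegree_linear_le
  have du : ∀ k, (u k).natDegree ≤ k := fun k => (hp'.natDegree_eq k).le
  have dp : ∀ k, (p k).natDegree ≤ k := fun k => (hp.natDegree_eq k).le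
  have cu : ∀ k, (D.defPlusPoly t * u k).coeff (1 + k) = -D.b6⁻¹ * gam u k := fun k => by
    rw [coeff_mul_add_eq_of_natDegree_le d1 (du k), coeff_one_defPlusPoly, hp'.gam_eq]
  have cp : ∀ k, (D.defMinusPoly t * p k).coeff (1 + k) = -D.b6 * gam p k := fun k => by
    rw [coeff_mul_add_eq_of_natDegree_le d2 (dp k), coeff_one_defMinusPoly, hp.gam_eq]
  have o1 := fun k => hp.isOrthogonal hw k
  have o2 := fun k => hp'.isOrthogonal hw' k
  have dαu : ∀ k l, k + 1 ≤ l → (D.defPlusPoly t * u k).natDegree ≤ l := fun k l hl =>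
    natDegree_mul_le_add d1 (du k) (by omega)
  have dβp : ∀ k l, k + 1 ≤ l → (D.defMinusPoly t * p k).natDegree ≤ l := fun k l hl =>
    natDegree_mul_le_add d2 (dp k) (by omega)
  set cr : ℕ → ℕ → ℂ[X] := fun i j =>
    crossPoly hw hw' (D.defPlusPoly t) (D.defMinusPoly t) (p i) (u j) with hcr
  have e00 : ∀ x, recA p (m + 1) * (cr m (m + 1)).eval x =
      -(gam u (m + 1) / (D.b6 * gam p (m + 1)) * x) + recA p (m + 1) * (cr m (m + 1)).coeff 0 := by
    intro x
    have hd : (cr m (m + 1)).natDegree ≤ 1 := by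
      refine (natDegree_sub_le _ _).trans (max_le ?_ ?_)
      · exact (o1 m).natDegree_secondKind_le (dαu _ _ (by omega))
      · exact (o2 (m + 1)).natDegree_secondKind_le (dβp _ _ (by omega))
    have hc : (cr m (m + 1)).coeff 1 = (gam p m)⁻¹ * (-D.b6⁻¹ * gam u (m + 1)) := by
      rw [hcr]
      simp only [crossPoly]
      rw [(o2 (m + 1)).secondKind_eq_zero (dβp _ _ (by omega)), sub_zero,
        (o1 m).coeff_secondKind (dαu _ _ (by omega)), show m + 1 + 1 = 1 + (m + 1) by ring, cu]
    rw [eval_of_natDegree_le_one hd, hc, ra]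
    field_simp
  have e11 : ∀ x, recA p (m + 1) * (cr (m + 1) m).eval x =
      D.b6 * gam p m / gam u m * x + recA p (m + 1) * (cr (m + 1) m).coeff 0 := by
    intro x
    have hd : (cr (m + 1) m).natDegree ≤ 1 := by
      refine (natDegree_sub_le _ _).trans (max_le ?_ ?_)
      · exact (o1 (m + 1)).natDegree_secondKind_le (dαu _ _ (by omega))
      · exact (o2 m).natDegree_secondKind_le (dβp _ _ (by omega))
    have hc : (cr (m + 1) m).coeff 1 = (gam u m)⁻¹ * (D.b6 * gam p (m + 1)) := by
      rw [hcr]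
      simp only [crossPoly]
      rw [(o1 (m + 1)).secondKind_eq_zero (dαu _ _ (by omega)), zero_sub, coeff_neg,
        (o2 m).coeff_secondKind (dβp _ _ (by omega)), show m + 1 + 1 = 1 + (m + 1) by ring, cp]
      ring
    rw [eval_of_natDegree_le_one hd, hc, ra]
    field_simp
  have e01 : ∀ k x, (cr k k).eval x =
      -(gam u k / (D.b6 * gam p k) - D.b6 * gam p k / gam u k) := by
    intro k x
    have gk := hp.gam_ne_zero k
    have gk' := hp'.gam_ne_zero k
    have hd : (cr k k).natDegree ≤ 0 := by
      refine (natDegree_sub_le _ _).trans (max_le ?_ ?_)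
      · exact (o1 k).natDegree_secondKind_le (dαu _ _ (by omega))
      · exact (o2 k).natDegree_secondKind_le (dβp _ _ (by omega))
    rw [eval_of_natDegree_le_zero hd, hcr]
    simp only [crossPoly]
    rw [coeff_sub, (o1 k).coeff_secondKind (dαu _ _ (by omega)),
      (o2 k).coeff_secondKind (dβp _ _ (by omega)), show k + 0 + 1 = 1 + k by ring, cu, cp]
    field_simp
    ring
  refine ⟨-(recA p (m + 1) * (cr m (m + 1)).coeff 0) / (gam u (m + 1) / (D.b6 * gam p (m + 1))),
    recA p (m + 1) * (cr (m + 1) m).coeff 0 / (D.b6 * gam p m / gam u m), fun x hx => ?_⟩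
  have hx' := hx.time_q_mul hD
  have key := h.transferMatrix_mul (n := m + 1) (by omega) hw' (α := D.defPlusPoly t)
    (β := D.defMinusPoly t) (fun y hy => by
      rw [eval_defPlusPoly, eval_defMinusPoly, (h'.offPoles hy).weight_time hD h.t_ne])
    (u (m + 1)) (u m) hx (hx'.weight_ne_zero hD h'.t_ne) (by
      rw [eval_defPlusPoly, eval_defMinusPoly, (hx'.offPoles hD).weight_time hD h.t_ne])
  rw [eval_defPlusPoly] at key
  change D.defPlus t x • D.Y P (m + 1) (D.q * t) x = _ at key
  rw [neg_smul, key, ← Matrix.neg_mul]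
  congr 1
  ext i j
  fin_cases i <;> fin_cases j <;>
    simp only [transferMatrix, defPoly, Matrix.map_apply, Matrix.neg_apply, Matrix.of_apply,
      Matrix.cons_val', Matrix.cons_val_zero, Matrix.cons_val_one, Matrix.cons_val_fin_one,
      Nat.add_sub_cancel, eval_neg, eval_mul, eval_C, Fin.zero_eta, Fin.mk_one, Fin.isValue]
  · rw [e00, ← hpdef, ← hudef]
    field_simp
    ring
  · rw [e01]
    ring
  · rw [e01]
    ring
  · rw [e11, ← hpdef, ← hudef]
    field_simp

/-! ### Cayley transforms -/

/-- With `M` the mean, the two factors are `Y₀ M⁻¹` and `Y₁ M⁻¹`, so the transform is `M Y₀⁻¹ Y₁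
M⁻¹`. As `M` is a combination of `Y₀` and `Y₁`, `M Y₀⁻¹ Y₁ = Y₁ Y₀⁻¹ M`. -/
lemma cayley_mul_inv {Y₀ Y₁ : Matrix (Fin 2) (Fin 2) ℂ} {δ : ℂ} (hδ : δ ≠ 0) (h₀ : Y₀.det ≠ 0)
    (hM : ((2 : ℂ)⁻¹ • (Y₁ + Y₀)).det ≠ 0) :
    cayley δ (δ⁻¹ • (Y₁ - Y₀) * ((2 : ℂ)⁻¹ • (Y₁ + Y₀))⁻¹) = Y₁ * Y₀⁻¹ := by
  set M := (2 : ℂ)⁻¹ • (Y₁ + Y₀) with hMd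
  have u₀ : IsUnit Y₀.det := isUnit_iff_ne_zero.2 h₀
  have uM : IsUnit M.det := isUnit_iff_ne_zero.2 hM
  have hN : (δ / 2) • (δ⁻¹ • (Y₁ - Y₀) * M⁻¹) = (2 : ℂ)⁻¹ • (Y₁ - Y₀) * M⁻¹ := by
    rw [← Matrix.smul_mul, smul_smul]
    congr 2
    field_simp
  have hM1 : (1 : Matrix (Fin 2) (Fin 2) ℂ) = M * M⁻¹ := (Matrix.mul_nonsing_inv _ uM).symm
  have e1 : 1 - (δ / 2) • (δ⁻¹ • (Y₁ - Y₀) * M⁻¹) = Y₀ * M⁻¹ := by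
    rw [hN]
    nth_rewrite 1 [hM1]
    rw [← Matrix.sub_mul, hMd, ← smul_sub]
    congr 1
    module
  have e2 : 1 + (δ / 2) • (δ⁻¹ • (Y₁ - Y₀) * M⁻¹) = Y₁ * M⁻¹ := by
    rw [hN]
    nth_rewrite 1 [hM1]
    rw [← Matrix.add_mul, hMd, ← smul_add]
    congr 1
    module
  rw [cayley, e1, e2, Matrix.mul_inv_rev, Matrix.nonsing_inv_nonsing_inv _ uM]
  have e3 : M * Y₀⁻¹ * Y₁ = Y₁ * Y₀⁻¹ * M := by
    rw [hMd]
    simp only [Matrix.smul_mul, Matrix.mul_smul, Matrix.add_mul, Matrix.mul_add,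
      Matrix.mul_nonsing_inv _ u₀, Matrix.mul_assoc, Matrix.nonsing_inv_mul _ u₀, Matrix.mul_one,
      Matrix.one_mul]
  rw [← Matrix.mul_assoc, e3, Matrix.mul_assoc, Matrix.mul_nonsing_inv _ uM, Matrix.mul_one]

lemma delta_ne_zero (hD : D.Nondegenerate) {z : ℂ} (hz : z ≠ 0) : D.delta z ≠ 0 :=
  mul_ne_zero hD.q_sub_one_ne hz

lemma Admissible.specPlus_ne_zero (hD : D.Nondegenerate) {t x : ℂ} (h : D.Admissible t x) :
    D.specPlus t x ≠ 0 := by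
  have h1 := h.2 D.b1⁻¹ (by simp) 0
  have h4 := h.2 D.b4⁻¹ (by simp) 0
  have h6 := h.2 (t / D.b6) (by simp) 0
  have b1 := hD.b1_ne
  have b4 := hD.b4_ne
  have b6 := hD.b6_ne
  simp only [zpow_zero, mul_one] at h1 h4 h6
  rw [specPlus]
  refine mul_ne_zero (mul_ne_zero (mul_ne_zero b6 ?_) ?_) ?_
  · exact fun e => h1 (by field_simp; linear_combination -e)
  · exact fun e => h4 (by field_simp; linear_combination -e)
  · exact fun e => h6 (by field_simp; linear_combination -e)

lemma countable_not_admissible (t : ℂ) : {x | ¬ D.Admissible t x}.Countable := by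
  have : {x | ¬ D.Admissible t x} ⊆ {0} ∪
      ⋃ c ∈ ({D.b1⁻¹, D.b2⁻¹, D.b3⁻¹, D.b4⁻¹, D.b6 * t, t / D.b6} : Set ℂ),
        Set.range fun k : ℤ => c * D.q ^ k := by
    intro x hx
    by_contra hc
    simp only [Set.mem_union, Set.mem_singleton_iff, Set.mem_iUnion, Set.mem_range, exists_prop,
      not_or, not_exists, not_and] at hc
    exact hx ⟨hc.1, fun c hcm k hk => hc.2 c hcm k hk.symm⟩
  refine Set.Countable.mono this ((Set.countable_singleton _).union ?_)
  refine Set.Countable.biUnion (Set.toFinite _).countable fun c _ => Set.countable_range _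

lemma infinite_admissible (t : ℂ) {r : ℂ[X]} (hr : r ≠ 0) :
    {x | D.Admissible t x ∧ r.eval x ≠ 0}.Infinite := by
  intro hfin
  have h1 : {x | r.eval x = 0}.Finite :=
    (r.roots.toFinset.finite_toSet).subset fun x hx => by
      simpa [hr] using hx
  refine not_countable_complex ?_
  refine ((countable_not_admissible (D := D) t).union
    (hfin.countable.union h1.countable)).mono fun x _ => ?_
  by_cases ha : D.Admissible t x
  · by_cases h0 : r.eval x = 0
    · exact Or.inr (Or.inr h0)
    · exact Or.inr (Or.inl ⟨ha, h0⟩)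
  · exact Or.inl ha

lemma poly_ext_of_admissible (t : ℂ) {s r₁ r₂ : ℂ[X]} (hs : s ≠ 0)
    (h : ∀ x, D.Admissible t x → s.eval x ≠ 0 → r₁.eval x = r₂.eval x) : r₁ = r₂ :=
  eq_of_infinite_eval_eq _ _ ((infinite_admissible (D := D) t hs).mono fun x hx => h x hx.1 hx.2)

/-- Twice `W + Δy V` times the mean is `(A + (W + Δy V)) Y`, so invertibility can fail only at zeros
of one polynomial. This makes the polynomial matrix selected in `specStar` unique. -/
lemma IsSystem.det_mean {t : ℂ} {P : ℂ → ℕ → ℂ[X]} (h : D.IsSystem t (P t)) {n : ℕ}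
    (hn : 1 ≤ n) {A : Matrix (Fin 2) (Fin 2) ℂ[X]} (hA : D.IsSpecPoly P n t A) {x : ℂ}
    (hx : D.Admissible t x)
    (h0 : ((A 0 0 + D.specPlusPoly t) * (A 1 1 + D.specPlusPoly t) - A 0 1 * A 1 0).eval x ≠ 0) :
    (D.mean (D.Y P n t) x).det ≠ 0 := by
  have hsp := hx.specPlus_ne_zero h.nondegenerate
  have e : D.specPlus t x • (D.Y P n t (D.q * x) + D.Y P n t x) =
      (A.map (fun r => r.eval x) + D.specPlus t x • 1) * D.Y P n t x := by
    rw [smul_add, hA.smul_Y x hx, Matrix.add_mul, Matrix.smul_mul, Matrix.one_mul]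
  have e2 := congrArg Matrix.det e
  rw [Matrix.det_mul, Matrix.det_smul] at e2
  have e3 : (A.map (fun r => r.eval x) + D.specPlus t x • 1).det ≠ 0 := by
    rw [Matrix.det_fin_two]
    simpa [eval_specPlusPoly] using h0
  rw [mean, Matrix.det_smul]
  refine mul_ne_zero (by simp) fun h1 => ?_
  rw [h1, mul_zero, eq_comm] at e2
  exact mul_ne_zero e3 (h.det_Y_ne_zero hn hx) e2

lemma IsSystem.cayley_specMatrix {t : ℂ} {P : ℂ → ℕ → ℂ[X]} (h : D.IsSystem t (P t)) {n : ℕ}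
    (hn : 1 ≤ n) {A : Matrix (Fin 2) (Fin 2) ℂ[X]} (hA : D.IsSpecPoly P n t A) :
    D.IsSpecStar P n t A := by
  intro x hx hM
  have hY := h.det_Y_ne_zero hn hx
  rw [specMatrix, ddo, mean, cayley_mul_inv (delta_ne_zero h.nondegenerate hx.1) hY hM,
    ← Matrix.smul_mul, hA.smul_Y x hx, Matrix.mul_assoc,
    Matrix.mul_nonsing_inv _ (isUnit_iff_ne_zero.2 hY), Matrix.mul_one]

/-- The matrix `A*_n` is the polynomial matrix of the Lax pair. -/
lemma IsSystem.specStar_eq {t : ℂ} {P : ℂ → ℕ → ℂ[X]} (h : D.IsSystem t (P t)) {n : ℕ}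
    (hn : 1 ≤ n) {A : Matrix (Fin 2) (Fin 2) ℂ[X]} (hA : D.IsSpecPoly P n t A) :
    D.specStar P n t = A := by
  have h1 := h.cayley_specMatrix hn hA
  have h2 : D.IsSpecStar P n t (D.specStar P n t) := Classical.epsilon_spec ⟨A, h1⟩
  set s := (A 0 0 + D.specPlusPoly t) * (A 1 1 + D.specPlusPoly t) - A 0 1 * A 1 0 with hs
  -- The constant term of `s` is `(2 b₆ t)²`.
  have hs0 : s ≠ 0 := by
    intro h0
    have h3 := congrArg (fun r => r.coeff 0) h0
    have h4 : (D.specPlusPoly t).coeff 0 = D.b6 * t := by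
      rw [coeff_zero_eq_eval_zero, eval_specPlusPoly]; simp [specPlus]
    simp only [hs, coeff_sub, mul_coeff_zero, coeff_add, hA.coeff_zero₀₀, hA.coeff_zero₀₁,
      hA.coeff_zero₁₁, h4, coeff_zero, zero_mul, sub_zero] at h3
    have : D.b6 * t ≠ 0 := mul_ne_zero h.nondegenerate.b6_ne h.t_ne
    rw [mul_self_eq_zero, ← two_mul] at h3
    exact mul_ne_zero two_ne_zero this h3
  ext1 i j
  refine poly_ext_of_admissible (D := D) t hs0 fun x hx hsx => ?_
  have hM := h.det_mean hn hA hx hsx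
  have := (h2 x hx hM).trans (h1 x hx hM).symm
  exact congrFun (congrFun this i) j

lemma IsSystem.defStar_eq {t : ℂ} {P : ℂ → ℕ → ℂ[X]} (h : D.IsSystem t (P t)) {n : ℕ}
    (hn : 1 ≤ n) {x : ℂ} (hx : D.Admissible t x) {B : Matrix (Fin 2) (Fin 2) ℂ}
    (hB : (-(D.defPlus t x)) • D.Y P n (D.q * t) x = B * D.Y P n t x)
    (hM : (D.mean (D.YT P n x) t).det ≠ 0) : D.defStar P n t x = B := by
  have hY := h.det_Y_ne_zero hn hx
  have ha : recA (P t) n ≠ 0 := h.isOPS.recA_ne_zero n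
  have hY' : (D.YT P n x t).det ≠ 0 := hY
  rw [defStar, defMatrix, ddo, mean, cayley_mul_inv (delta_ne_zero h.nondegenerate h.t_ne) hY' hM,
    -- The normalisation `H_n = -a_n / 2` amounts to the sign in `-(R + Δu S)`.
    show 2 * decoupling P n t * D.defPlus t x / recA (P t) n = -D.defPlus t x by
      rw [decoupling]; field_simp,
    ← Matrix.smul_mul]
  change (-D.defPlus t x) • D.Y P n (D.q * t) x * (D.Y P n t x)⁻¹ = B
  rw [hB, Matrix.mul_assoc, Matrix.mul_nonsing_inv _ (isUnit_iff_ne_zero.2 hY), Matrix.mul_one]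

/-! ### Elementary algebra of the compatibility relations -/

/-- The remaining linear factor is fixed by the leading and constant coefficients alone, so unknown
middle coefficients drop out. -/
lemma cubic_eq_of_roots {x₁ x₂ c₀ c₁ c₂ c₃ : ℂ} (hne : x₁ ≠ x₂) (h₁₂ : x₁ * x₂ ≠ 0)
    (h₁ : c₃ * x₁ ^ 3 + c₂ * x₁ ^ 2 + c₁ * x₁ + c₀ = 0)
    (h₂ : c₃ * x₂ ^ 3 + c₂ * x₂ ^ 2 + c₁ * x₂ + c₀ = 0) (x : ℂ) :
    c₃ * x ^ 3 + c₂ * x ^ 2 + c₁ * x + c₀ = (x - x₁) * (x - x₂) * (c₃ * x + c₀ / (x₁ * x₂)) := by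
  have hd : x₁ - x₂ ≠ 0 := sub_ne_zero.2 hne
  have e₁ : c₃ * (x₁ ^ 2 + x₁ * x₂ + x₂ ^ 2) + c₂ * (x₁ + x₂) + c₁ = 0 :=
    (mul_eq_zero.1 (show (x₁ - x₂) * _ = 0 by linear_combination h₁ - h₂)).resolve_left hd
  have e₂ : c₃ * (x₁ + x₂) * (x₁ * x₂) + c₂ * (x₁ * x₂) - c₀ = 0 :=
    (mul_eq_zero.1 (show (x₁ - x₂) * _ = 0 by
      linear_combination x₂ * h₁ - x₁ * h₂)).resolve_left hd
  have e₃ : c₀ / (x₁ * x₂) = c₃ * (x₁ + x₂) + c₂ := by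
    rw [div_eq_iff h₁₂]; linear_combination -e₂
  rw [e₃]
  linear_combination x * e₁ - e₂

lemma quartic_eq_of_roots {x₁ x₂ c₀ c₁ c₂ c₃ c₄ : ℂ} (hne : x₁ ≠ x₂) (h₁₂ : x₁ * x₂ ≠ 0)
    (h₁ : c₄ * x₁ ^ 4 + c₃ * x₁ ^ 3 + c₂ * x₁ ^ 2 + c₁ * x₁ + c₀ = 0)
    (h₂ : c₄ * x₂ ^ 4 + c₃ * x₂ ^ 3 + c₂ * x₂ ^ 2 + c₁ * x₂ + c₀ = 0) (x : ℂ) :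
    c₄ * x ^ 4 + c₃ * x ^ 3 + c₂ * x ^ 2 + c₁ * x + c₀ =
      (x - x₁) * (x - x₂) * (c₄ * x ^ 2 + (c₃ + c₄ * (x₁ + x₂)) * x + c₀ / (x₁ * x₂)) := by
  have := cubic_eq_of_roots (c₃ := c₃ + c₄ * (x₁ + x₂)) (c₂ := c₂ - c₄ * (x₁ * x₂)) (c₁ := c₁)
    (c₀ := c₀) hne h₁₂ (by linear_combination h₁) (by linear_combination h₂) x
  linear_combination this

/-- The two outer coefficients are omitted: in the application they vanish by the choice of `E` and
by the values at `0`. -/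
lemma quartic_coeffs_eq_zero {x₁ x₂ h₀ h₁ h₂ h₃ h₄ : ℂ}
    (h : ∀ x : ℂ, (x - x₁) * (x - x₂) * (h₄ * x ^ 4 + h₃ * x ^ 3 + h₂ * x ^ 2 + h₁ * x + h₀) = 0) :
    h₁ = 0 ∧ h₂ = 0 ∧ h₃ = 0 := by
  set r : ℂ[X] := C h₄ * X ^ 4 + C h₃ * X ^ 3 + C h₂ * X ^ 2 + C h₁ * X + C h₀ with hr
  have h1 : (X - C x₁) * (X - C x₂) * r = 0 := by
    refine Polynomial.funext fun x => ?_
    simpa [hr] using h x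
  have h2 : r = 0 := (mul_eq_zero.1 h1).resolve_left
    (mul_ne_zero (X_sub_C_ne_zero x₁) (X_sub_C_ne_zero x₂))
  have h3 : ∀ i, r.coeff i = 0 := fun i => by rw [h2, coeff_zero]
  simp only [hr, coeff_add, coeff_C_mul_X_pow, coeff_C_mul_X, coeff_C] at h3
  exact ⟨by simpa using h3 1, by simpa using h3 2, by simpa using h3 3⟩

/-- The relation between the ratio `ρ` of leading coefficients and the variable `f`. -/
lemma ratio_relation {q t b5 b6 a a' ρ ρm rm f g A1 A2 : ℂ} (hq : q ≠ 0) (ht : t ≠ 0)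
    (hb5 : b5 ≠ 0) (hb6 : b6 ≠ 0) (hb6' : b6 ^ 2 ≠ 1) (ha : a ≠ 0) (hρ : ρ ≠ 0)
    (hρm : ρm * a' = a / ρ) (hg : g ≠ 0) (hg1 : g ≠ b6 * (q * t)) (hg2 : g ≠ q * t / b6)
    (hf : q * t * (-(b5 * b6) * g ^ 3 + A2 * g ^ 2 + A1 * g + b6 * (q * t)) =
      (g - b6 * (q * t)) * (b6 * g - q * t) * (1 - f * g))
    (h : ∀ x, x = b6 * (q * t) ∨ x = q * t / b6 →
      (-(b5 * b6) * x ^ 3 + A2 * x ^ 2 + A1 * x + b6 * (q * t)) * (a * (ρ - 1 / ρ)) =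
        a' * b6 * (b5 - (q * b5)⁻¹) * (x * (x - g)) * (ρm * (x + rm))) :
    q * t * b5 ^ 2 * ρ ^ 2 - t = b5 * f * (ρ ^ 2 - 1) := by
  have hne : b6 * (q * t) ≠ q * t / b6 := by
    intro e
    rw [eq_div_iff hb6] at e
    apply hb6'
    have : q * t ≠ 0 := mul_ne_zero hq ht
    apply mul_left_cancel₀ this
    linear_combination e
  have h12 : b6 * (q * t) * (q * t / b6) ≠ 0 := by positivity
  set Pp := a * (ρ - 1 / ρ) with hPp
  set T := a / ρ * b6 * (b5 - (q * b5)⁻¹) with hT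
  have hT' : a' * b6 * (b5 - (q * b5)⁻¹) * ρm = T := by
    rw [hT, ← hρm]; ring
  -- The cubic is `𝔚₊ Pp` minus the `𝔗₊`-term. The unknown `rm` occurs only in its middle
  -- coefficients, and at `g` the `𝔗₊`-term vanishes, so that `hf` brings in `f`.
  have key := cubic_eq_of_roots (c₃ := -(b5 * b6) * Pp - T) (c₂ := A2 * Pp - T * (rm - g))
    (c₁ := A1 * Pp + T * g * rm) (c₀ := b6 * (q * t) * Pp) hne h12
    (by linear_combination h _ (Or.inl rfl) + (b6 * (q * t)) * (b6 * (q * t) - g) * (b6 * (q * t) + rm) * hT')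
    (by linear_combination h _ (Or.inr rfl) + (q * t / b6) * (q * t / b6 - g) * (q * t / b6 + rm) * hT') g
  have s1 : g - b6 * (q * t) ≠ 0 := sub_ne_zero.2 hg1
  have s2 : g - q * t / b6 ≠ 0 := sub_ne_zero.2 hg2
  have e1 : q * t * ((-(b5 * b6) * Pp - T) * g + b6 * (q * t) * Pp / (b6 * (q * t) * (q * t / b6))) =
      Pp * b6 * (1 - f * g) := by
    apply mul_left_cancel₀ (mul_ne_zero s1 s2)
    have e2 : (g - b6 * (q * t)) * (b6 * g - q * t) = (g - b6 * (q * t)) * (g - q * t / b6) * b6 := by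
      field_simp
    rw [e2] at hf
    linear_combination (-(q * t)) * key + Pp * hf
  have e3 : q * t * (b6 * (q * t) * Pp / (b6 * (q * t) * (q * t / b6))) = Pp * b6 := by
    field_simp
  have e4 : q * t * (-(b5 * b6) * Pp - T) + Pp * b6 * f = 0 := by
    apply mul_left_cancel₀ hg
    linear_combination e1 - e3
  rw [hPp, hT] at e4
  field_simp at e4
  apply mul_left_cancel₀ (mul_ne_zero hb6 ha)
  linear_combination (-1 : ℂ) * e4

/-- Elimination of the coefficients of the spectral matrix. -/
lemma constant_term_elimination {q t b5 b6 e1 e2 e3 f g r u α1 α2 E : ℂ} (hq : q ≠ 0) (ht : t ≠ 0)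
    (hb5 : b5 ≠ 0) (hb6 : b6 ≠ 0) (h52 : b5 ^ 2 ≠ 1) (hfg : f * g ≠ 1) (hg : g ≠ 0)
    (htg : t * g ≠ b5) (hft : f * b5 ≠ t) (hE : E * (q * b5) = t - b5 * f)
    (hu : u = q * α2 - r * (b5 * b6) - t * (b6 + 1 / b6) * q * (b5 * b6))
    (h1 : E * g * (r * b6 / t) + α1 - f * (b6 * t) = -(b6 * t * e1))
    (h2 : -(E * (r * b6 / t)) + E * g * u + α2 - f * α1 = b6 * t * e2)
    (h3 : -(E * u) - E * g * q * (b5 * b6) - b5 * b6 - f * α2 = -(b6 * t * e3)) :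
    r = 1 / (1 - b5 ^ 2) *
      (-(q * (t ^ 2 * b6 + g ^ 2 * b5 ^ 2 * b6 - t * g * b5 ^ 2 * (1 + b6 ^ 2))) / (g * b6)
        + q * t ^ 2 * b5 * (1 - e1 * g + e2 * g ^ 2 - e3 * g ^ 3 + g ^ 4) /
            (g * (f * g - 1) * (t * g - b5))
        - q * (t ^ 4 - e1 * b5 * t ^ 3 + e2 * b5 ^ 2 * t ^ 2 - e3 * b5 ^ 3 * t + b5 ^ 4) /
            ((t * g - b5) * (f * b5 - t))) := by
  have hE' : E = (t - b5 * f) / (q * b5) := by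
    rw [eq_div_iff (mul_ne_zero hq hb5)]; exact hE
  have d1 : 1 - b5 ^ 2 ≠ 0 := sub_ne_zero.2 h52.symm
  have d2 : f * g - 1 ≠ 0 := sub_ne_zero.2 hfg
  have d3 : t * g - b5 ≠ 0 := sub_ne_zero.2 htg
  have d4 : f * b5 - t ≠ 0 := sub_ne_zero.2 hft
  have d5 : b5 * f - t ≠ 0 := by rwa [mul_comm b5 f]
  have h1' : E * g * r * b6 + t * α1 - f * b6 * t ^ 2 = -(b6 * t ^ 2 * e1) := by
    field_simp at h1
    linear_combination h1
  have h2' : -(E * r * b6) + t * (E * g * u) + t * α2 - t * f * α1 = b6 * t ^ 2 * e2 := by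
    field_simp at h2
    linear_combination h2
  set β := b6 + 1 / b6 with hβ
  -- `h2' + f h1'` removes `α1`; adding the multiple of `h3` removes `α2`, since `E q b5 + f b5 =
  -- t`. What multiplies `r` is the determinant of the system.
  have key : r * ((f * b5 - t) * b6 * (1 - b5 ^ 2) * (1 - f * g)) = q * b5 *
      (b6 * t ^ 2 * e2 + f * (f * b6 * t ^ 2 - b6 * t ^ 2 * e1)
        + t * (E * g * (t * β * q * (b5 * b6))))
        + q * b5 ^ 2 * (1 + E * g * q) * (b5 * b6 - b6 * t * e3 + E * g * q * (b5 * b6)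
          - E * (t * β * q * (b5 * b6))) := by
    subst hu
    linear_combination q * b5 * (h2' + f * h1') + q * b5 ^ 2 * (1 + E * g * q) * h3 +
      (α2 * q * b5 * (1 + E * g * q) - r * (b6 * (b5 ^ 2 - 1) * (1 - f * g) +
        E * q * b5 ^ 2 * b6 * g)) * hE
  have hc : (f * b5 - t) * b6 * (1 - b5 ^ 2) * (1 - f * g) ≠ 0 :=
    mul_ne_zero (mul_ne_zero (mul_ne_zero d4 hb6) d1) (sub_ne_zero.2 hfg.symm)
  apply mul_right_cancel₀ hc
  rw [key, hE', hβ]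
  -- The determinant does not contain `t g - b5`; that denominator comes from the partial fractions
  -- based on `b5 (f g - 1) - g (f b5 - t) = t g - b5`.
  field_simp
  ring

/-- This makes the off-diagonal entry `Pp` of the deformation matrix nonzero, so that it can be
divided out. -/
lemma ratio_sq_ne_one {q t b5 f ρ : ℂ} (ht : t ≠ 0) (h51 : b5 ^ 2 * q ≠ 1)
    (hR : q * t * b5 ^ 2 * ρ ^ 2 - t = b5 * f * (ρ ^ 2 - 1)) : ρ ^ 2 - 1 ≠ 0 := by
  intro h
  have h1 : t * (b5 ^ 2 * q - 1) = 0 := by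
    linear_combination hR - (q * t * b5 ^ 2 - b5 * f) * h
  exact mul_ne_zero ht (sub_ne_zero.2 h51) h1

lemma mul_b5_ne {q t b5 f ρ : ℂ} (ht : t ≠ 0) (hρ : ρ ≠ 0) (h51 : b5 ^ 2 * q ≠ 1)
    (hR : q * t * b5 ^ 2 * ρ ^ 2 - t = b5 * f * (ρ ^ 2 - 1)) : f * b5 ≠ t := by
  intro h
  have h1 : t * ρ ^ 2 * (b5 ^ 2 * q - 1) = 0 := by linear_combination hR + (ρ ^ 2 - 1) * h
  exact mul_ne_zero (mul_ne_zero ht (pow_ne_zero 2 hρ)) (sub_ne_zero.2 h51) h1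

/-- The constant term of the first diagonal entry of the deformation matrix. -/
lemma constant_term_formula {q t b5 b6 e1 e2 e3 a ρ f g r α1 α2 δ1 δ2 c1 c2 : ℂ} (hq : q ≠ 0)
    (ht : t ≠ 0) (hb5 : b5 ≠ 0) (hb6 : b6 ≠ 0) (hb6' : b6 ^ 2 ≠ 1) (ha : a ≠ 0) (hρ : ρ ≠ 0)
    (h51 : b5 ^ 2 * q ≠ 1) (h52 : b5 ^ 2 ≠ 1) (hfg : f * g ≠ 1) (hg : g ≠ 0) (htg : t * g ≠ b5)
    (hR : q * t * b5 ^ 2 * ρ ^ 2 - t = b5 * f * (ρ ^ 2 - 1))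
    (hdet : ∀ x : ℂ, (-(b5 * b6) * x ^ 3 + α2 * x ^ 2 + α1 * x + b6 * t) *
        (-(b6 / b5) * x ^ 3 + δ2 * x ^ 2 + δ1 * x + b6 * t) -
        a * b6 * (b5 - (q * b5)⁻¹) * (x * (x - g)) * (c2 * x ^ 2 + c1 * x) =
      b6 * (1 - e1 * x + e2 * x ^ 2 - e3 * x ^ 3 + x ^ 4) * ((t - b6 * x) * (b6 * t - x)))
    (h0 : ∀ x, x = b6 * t ∨ x = t / b6 →
      ρ * (q * x + r) * (-(b5 * b6) * x ^ 3 + α2 * x ^ 2 + α1 * x + b6 * t) =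
        a * (ρ - 1 / ρ) * (c2 * x ^ 2 + c1 * x))
    (h1 : ∀ x, x = b6 * t ∨ x = t / b6 →
      ρ * (q * x + r) * (a * b6 * (b5 - (q * b5)⁻¹) * (x * (x - g))) =
        a * (ρ - 1 / ρ) * (-(b6 / b5) * x ^ 3 + δ2 * x ^ 2 + δ1 * x + b6 * t)) :
    r = 1 / (1 - b5 ^ 2) *
      (-(q * (t ^ 2 * b6 + g ^ 2 * b5 ^ 2 * b6 - t * g * b5 ^ 2 * (1 + b6 ^ 2))) / (g * b6)
        + q * t ^ 2 * b5 * (1 - e1 * g + e2 * g ^ 2 - e3 * g ^ 3 + g ^ 4) /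
            (g * (f * g - 1) * (t * g - b5))
        - q * (t ^ 4 - e1 * b5 * t ^ 3 + e2 * b5 ^ 2 * t ^ 2 - e3 * b5 ^ 3 * t + b5 ^ 4) /
            ((t * g - b5) * (f * b5 - t))) := by
  have hft := mul_b5_ne ht hρ h51 hR
  have hρ1 := ratio_sq_ne_one ht h51 hR
  have hne : b6 * t ≠ t / b6 := by
    intro e
    rw [eq_div_iff hb6] at e
    exact hb6' (mul_left_cancel₀ ht (by linear_combination e))
  have h12 : b6 * t * (t / b6) = t ^ 2 := by field_simp
  have h12' : b6 * t * (t / b6) ≠ 0 := by rw [h12]; positivity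
  set Pp := a * (ρ - 1 / ρ) with hPp
  set T := a * b6 * (b5 - (q * b5)⁻¹) with hT
  set E := (t - b5 * f) / (q * b5) with hE
  have hE' : E * (q * b5) = t - b5 * f := div_mul_cancel₀ _ (mul_ne_zero hq hb5)
  have hPp0 : Pp ≠ 0 := by
    have : Pp = a * (ρ ^ 2 - 1) / ρ := by rw [hPp]; field_simp
    rw [this]
    positivity
  -- The relation `hR` is used here: it lets `ρ` and `a` disappear together with the common factor
  -- `Pp * b6 / t`.
  have hρT : ρ * T = -(E * (Pp * b6 / t)) := by
    rw [hT, hE, hPp]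
    field_simp
    linear_combination hR
  have hc3 : -(b6 / b5) * Pp - ρ * q * T = -(Pp * b6 / t * f) := by
    have : ρ * q * T = -(q * E * (Pp * b6 / t)) := by linear_combination q * hρT
    rw [this, hE]
    field_simp
    ring
  set u := q * α2 - r * (b5 * b6) - t * (b6 + 1 / b6) * q * (b5 * b6) with hu
  have hQ : ∀ x, (t - b6 * x) * (b6 * t - x) = b6 * ((x - b6 * t) * (x - t / b6)) := fun x => by
    field_simp
    ring
  -- The identity used is `Pp det A = A₀₀ (Pp A₁₁ - ρ(qx + r) A₀₁) + A₀₁ (ρ(qx + r) A₀₀ - Pp A₁₀)`.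
  -- By `h1` and `h0` both brackets are divisible by the quadratic; the first is that quadratic
  -- times `(Pp b6 / t)(1 - f x)`.
  have key : ∀ x : ℂ, (x - b6 * t) * (x - t / b6) *
      ((-(f * -(b5 * b6)) - E * (q * -(b5 * b6)) - b6 * t) * x ^ 4 +
        (-(b5 * b6) - f * α2 - E * u - E * g * q * (b5 * b6) + b6 * t * e3) * x ^ 3 +
        (α2 - f * α1 - E * (r * b6 / t) + E * g * u - b6 * t * e2) * x ^ 2 +
        (α1 - f * (b6 * t) + E * g * (r * b6 / t) + b6 * t * e1) * x + 0) = 0 := by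
    intro x
    have k1 := cubic_eq_of_roots (c₃ := -(b6 / b5) * Pp - ρ * q * T)
      (c₂ := δ2 * Pp - ρ * T * (r - q * g)) (c₁ := δ1 * Pp + ρ * T * r * g) (c₀ := b6 * t * Pp)
      hne h12' (by linear_combination -h1 _ (Or.inl rfl)) (by linear_combination -h1 _ (Or.inr rfl)) x
    have k0 := quartic_eq_of_roots (c₄ := ρ * q * -(b5 * b6)) (c₃ := ρ * (q * α2 + r * -(b5 * b6)))
      (c₂ := ρ * (q * α1 + r * α2) - Pp * c2) (c₁ := ρ * (q * (b6 * t) + r * α1) - Pp * c1)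
      (c₀ := ρ * r * (b6 * t)) hne h12' (by linear_combination h0 _ (Or.inl rfl))
      (by linear_combination h0 _ (Or.inr rfl)) x
    rw [hc3, h12] at k1
    rw [h12] at k0
    have hd := hdet x
    rw [hQ] at hd
    apply mul_left_cancel₀ (show Pp * b6 / t ≠ 0 by positivity)
    rw [mul_zero]
    set Q := (x - b6 * t) * (x - t / b6) with hQd
    set A := -(b5 * b6) * x ^ 3 + α2 * x ^ 2 + α1 * x + b6 * t with hA
    have k2 : Q * (A * (-(Pp * b6 / t * f) * x + b6 * t * Pp / t ^ 2) +
        ρ * T * (x * (x - g)) * (q * -(b5 * b6) * x ^ 2 + u * x + r * (b6 * t) / t ^ 2)) =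
        Pp * b6 * (1 - e1 * x + e2 * x ^ 2 - e3 * x ^ 3 + x ^ 4) * (b6 * Q) := by
      have hu2 : ρ * u = ρ * (q * α2 + r * -(b5 * b6)) +
          ρ * q * -(b5 * b6) * (b6 * t + t / b6) := by rw [hu]; ring
      have e0 : ρ * r * (b6 * t) / t ^ 2 = ρ * (r * (b6 * t) / t ^ 2) := by ring
      rw [← hu2, e0] at k0
      linear_combination Pp * hd - A * (k1 + x ^ 3 * hc3) - (T * (x * (x - g))) * k0
    rw [hρT] at k2
    have e1' : b6 * t * Pp / t ^ 2 = Pp * b6 / t := by field_simp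
    have e2' : r * (b6 * t) / t ^ 2 = r * b6 / t := by field_simp
    have e3' : Pp * b6 = Pp * b6 / t * t := by field_simp
    rw [e1', e2', e3'] at k2
    rw [hA] at k2
    have e4' : Pp * b6 / t * t / t = Pp * b6 / t := by field_simp
    rw [e4'] at k2
    linear_combination k2
  obtain ⟨l1, l2, l3⟩ := quartic_coeffs_eq_zero key
  exact constant_term_elimination (α1 := α1) (α2 := α2) hq ht hb5 hb6 h52 hfg hg htg hft hE' hu
    (by linear_combination l1) (by linear_combination l2) (by linear_combination l3)

/-! ### Compatibility -/

lemma eq_of_admissible (t : ℂ) {f g : ℂ → ℂ} (hf : Continuous f) (hg : Continuous g)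
    (h : ∀ x, D.Admissible t x → f x = g x) (x : ℂ) : f x = g x := by
  have hd : Dense {x | ¬ D.Admissible t x}ᶜ := (countable_not_admissible t).dense_compl ℂ
  exact congrFun (Continuous.ext_on hd hf hg fun y hy => h y (by simpa using hy)) x

lemma matrix_mul_right_cancel {M N Y : Matrix (Fin 2) (Fin 2) ℂ} (hY : Y.det ≠ 0)
    (h : M * Y = N * Y) : M = N := by
  have u : IsUnit Y.det := isUnit_iff_ne_zero.2 hY
  rw [← Matrix.mul_nonsing_inv_cancel_right Y M u, h, Matrix.mul_nonsing_inv_cancel_right Y N u]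

/-- Both products carry `Y(x; t)` to multiples of `Y(qx; qt)`: shift time first or `x` first. The
factor `(1 - b₁x)(1 - b₄x)`, independent of `t`, is cancelled, leaving two quadratic scalars. -/
lemma IsSystem.compatibility {t : ℂ} {P : ℂ → ℕ → ℂ[X]} (h : D.IsSystem t (P t)) {n : ℕ}
    (hn : 1 ≤ n) {A A' : Matrix (Fin 2) (Fin 2) ℂ[X]} (hA : D.IsSpecPoly P n t A)
    (hA' : D.IsSpecPoly P n (D.q * t) A') {B : ℂ → Matrix (Fin 2) (Fin 2) ℂ}
    (hB : ∀ x, D.Admissible t x →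
      (-(D.defPlus t x)) • D.Y P n (D.q * t) x = B x * D.Y P n t x)
    {x : ℂ} (hx : D.Admissible t x) :
    ((D.b6 * D.q * t - D.q * x) * (t - D.b6 * x)) • (A'.map (fun r => r.eval x) * B x) =
      ((D.b6 * D.q * t - x) * (D.q * t - D.b6 * x)) • (B (D.q * x) * A.map (fun r => r.eval x)) := by
  have hD := h.nondegenerate
  have hb6 := hD.b6_ne
  have e1 := hA.smul_Y x hx
  have e2 := hA'.smul_Y x (hx.time_q_mul hD)
  have e3 := hB x hx
  have e4 := hB (D.q * x) (hx.q_mul hD)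
  have hsp := hx.specPlus_ne_zero hD
  have k1 : A'.map (fun r => r.eval x) * B x * D.Y P n t x =
      (-(D.defPlus t x) * D.specPlus (D.q * t) x) • D.Y P n (D.q * t) (D.q * x) := by
    rw [Matrix.mul_assoc, ← e3, Matrix.mul_smul, ← e2, smul_smul]
  have k2 : B (D.q * x) * A.map (fun r => r.eval x) * D.Y P n t x =
      (D.specPlus t x * -(D.defPlus t (D.q * x))) • D.Y P n (D.q * t) (D.q * x) := by
    rw [Matrix.mul_assoc, ← e1, Matrix.mul_smul, ← e4, smul_smul]
  have hc : (1 - D.b1 * x) * (1 - D.b4 * x) ≠ 0 := by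
    intro h0
    apply hsp
    rw [specPlus]
    linear_combination (D.b6 * (t - D.b6 * x)) * h0
  refine smul_right_injective _ hc ?_
  refine matrix_mul_right_cancel (h.det_Y_ne_zero hn hx) ?_
  simp only [Matrix.smul_mul, k1, k2, smul_smul]
  congr 1
  rw [specPlus, specPlus, defPlus, defPlus]
  field_simp

/-- Since `det Y = 1 / (a_n w)`, the determinant is read off from the equation of the weight on
admissible points, and extends by density. -/
lemma IsSystem.det_specPoly {t : ℂ} {P : ℂ → ℕ → ℂ[X]} (h : D.IsSystem t (P t)) {n : ℕ}
    (hn : 1 ≤ n) {A : Matrix (Fin 2) (Fin 2) ℂ[X]} (hA : D.IsSpecPoly P n t A) (x : ℂ) :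
    (A 0 0).eval x * (A 1 1).eval x - (A 0 1).eval x * (A 1 0).eval x =
      D.specPlus t x * D.specMinus t x := by
  have hD := h.nondegenerate
  refine eq_of_admissible (D := D) t (f := fun x => (A 0 0).eval x * (A 1 1).eval x -
    (A 0 1).eval x * (A 1 0).eval x)
    (g := fun x => D.specPlus t x * D.specMinus t x) (by fun_prop) (by unfold specPlus specMinus; fun_prop)
    (fun x hx => ?_) x
  have e := congrArg Matrix.det (hA.smul_Y x hx)
  rw [Matrix.det_smul, Matrix.det_mul, Matrix.det_fin_two (A.map _)] at e
  simp only [Matrix.map_apply, Fintype.card_fin] at e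
  have d1 := h.det_Y hn hx
  have d2 := h.det_Y hn (hx.q_mul hD)
  have hw := (hx.offPoles hD).weight_mul hD h.t_ne
  have hwq := (hx.q_mul hD).weight_ne_zero hD h.t_ne
  have hw0 := hx.weight_ne_zero hD h.t_ne
  have ha : recA (P t) n ≠ 0 := h.isOPS.recA_ne_zero n
  apply mul_right_cancel₀ hwq
  linear_combination (-(recA (P t) n * D.weight t x * D.weight t (D.q * x))) * e
    - ((A 0 0).eval x * (A 1 1).eval x - (A 0 1).eval x * (A 1 0).eval x) *
      D.weight t (D.q * x) * d1 + (D.specPlus t x ^ 2 * D.weight t x) * d2 - D.specPlus t x * hw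

lemma IsSystem.det_defPoly {t : ℂ} {P : ℂ → ℕ → ℂ[X]} (h : D.IsSystem t (P t))
    (h' : D.IsSystem (D.q * t) (P (D.q * t))) {n : ℕ} (hn : 1 ≤ n) {rp rm : ℂ}
    (hB : ∀ x, D.Admissible t x →
      (-(D.defPlus t x)) • D.Y P n (D.q * t) x = D.defPoly P n t rp rm x * D.Y P n t x) (x : ℂ) :
    recA (P (D.q * t)) n * (D.defPoly P n t rp rm x).det =
      recA (P t) n * (D.defPlus t x * D.defMinus t x) := by
  have hD := h.nondegenerate
  refine eq_of_admissible (D := D) t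
    (f := fun x => recA (P (D.q * t)) n * (D.defPoly P n t rp rm x).det)
    (g := fun x => recA (P t) n * (D.defPlus t x * D.defMinus t x))
    (by unfold defPoly; simp only [Matrix.det_fin_two_of]; fun_prop)
    (by unfold defPlus defMinus; fun_prop) (fun x hx => ?_) x
  have hx' := hx.time_q_mul hD
  have e := congrArg Matrix.det (hB x hx)
  rw [Matrix.det_smul, Matrix.det_mul] at e
  simp only [Fintype.card_fin] at e
  have d1 := h.det_Y hn hx
  have d2 := h'.det_Y hn hx'
  have hw := (hx'.offPoles hD).weight_time hD h.t_ne
  have hwq := hx'.weight_ne_zero hD h'.t_ne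
  apply mul_right_cancel₀ hwq
  linear_combination (-(recA (P t) n * D.weight t x * recA (P (D.q * t)) n *
      D.weight (D.q * t) x)) * e
    - recA (P (D.q * t)) n * (D.defPoly P n t rp rm x).det * D.weight (D.q * t) x * d1
    + (D.defPlus t x ^ 2 * D.weight t x * recA (P t) n) * d2 - D.defPlus t x * recA (P t) n * hw

/-! ### The variables `f` and `g` -/

lemma eval_of_natDegree_le_three {r : ℂ[X]} (h : r.natDegree ≤ 3) (x : ℂ) :
    r.eval x = r.coeff 3 * x ^ 3 + r.coeff 2 * x ^ 2 + r.coeff 1 * x + r.coeff 0 := by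
  rw [eval_eq_sum_range' (Nat.lt_succ_of_le h)]
  simp [Finset.sum_range_succ]
  ring

lemma eval_of_natDegree_le_two {r : ℂ[X]} (h : r.natDegree ≤ 2) (x : ℂ) :
    r.eval x = r.coeff 2 * x ^ 2 + r.coeff 1 * x + r.coeff 0 := by
  rw [eval_eq_sum_range' (Nat.lt_succ_of_le h)]
  simp [Finset.sum_range_succ]
  ring

/-- `b₅² q ≠ 1` says that the leading coefficient is nonzero, so `g` really is a zero and not a
default value of division. -/
lemma IsSystem.eval_specPoly_zero_one {t : ℂ} {P : ℂ → ℕ → ℂ[X]} (h : D.IsSystem t (P t)) {n : ℕ}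
    (hn : 1 ≤ n) {A : Matrix (Fin 2) (Fin 2) ℂ[X]} (hA : D.IsSpecPoly P n t A)
    (h51 : D.b5 n ^ 2 * D.q ≠ 1) (x : ℂ) :
    (A 0 1).eval x =
      recA (P t) n * D.b6 * (D.b5 n - (D.q * D.b5 n)⁻¹) * (x * (x - D.g P n t)) := by
  have hD := h.nondegenerate
  have hb5 := b5_ne_zero hD n
  have hq := hD.q_ne
  have ha := h.isOPS.recA_ne_zero n
  have hq1 := hD.q_sub_one_ne
  have hc : (A 0 1).coeff 2 ≠ 0 := by
    rw [hA.coeff₀₁]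
    refine mul_ne_zero (mul_ne_zero ha hD.b6_ne) fun e => h51 ?_
    field_simp at e
    linear_combination e
  have hg : D.g P n t = -(A 0 1).coeff 1 / (A 0 1).coeff 2 := by
    rw [g, Theta, h.specStar_eq hn hA, coeff_C_mul, coeff_C_mul, coeff_divX, coeff_divX, coeff_neg,
      coeff_neg]
    field_simp
  rw [eval_of_natDegree_le_two hA.natDegree₀₁, hA.coeff_zero₀₁, hg, ← hA.coeff₀₁]
  field_simp
  ring

/-- Unwinds `f`: `ν / g + (q - 1) μ` is `𝔚₊(g) / g`, so only the `(0,0)` entry enters `zPlus`, and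
`Z` is an affine function of it. -/
lemma IsSystem.eval_specPoly_g {t : ℂ} {P : ℂ → ℕ → ℂ[X]}
    (h' : D.IsSystem (D.q * t) (P (D.q * t))) {n : ℕ} (hn : 1 ≤ n)
    {A' : Matrix (Fin 2) (Fin 2) ℂ[X]} (hA' : D.IsSpecPoly P n (D.q * t) A')
    (hg0 : D.g P n (D.q * t) ≠ 0) (hg1 : D.g P n (D.q * t) - D.b6 * (D.q * t) ≠ 0)
    (hg2 : D.b6 * D.g P n (D.q * t) - D.q * t ≠ 0) :
    D.q * t * (A' 0 0).eval (D.g P n (D.q * t)) =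
      (D.g P n (D.q * t) - D.b6 * (D.q * t)) * (D.b6 * D.g P n (D.q * t) - D.q * t) *
        (1 - D.f P n t * D.g P n (D.q * t)) := by
  have hD := h'.nondegenerate
  have hb5 := b5_ne_zero hD n
  have hb6 := hD.b6_ne
  have hq1 := hD.q_sub_one_ne
  have hz : D.zPlus P n (D.q * t) =
      (A' 0 0).eval (D.g P n (D.q * t)) / D.g P n (D.q * t) / (-(D.b5 n * D.b6)) := by
    rw [zPlus, nu, mu, delta, h'.specStar_eq hn hA']
    field_simp
    ring
  rw [f, Z, hz]
  generalize D.g P n (D.q * t) - D.b6 * (D.q * t) = u₁ at *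
  generalize D.b6 * D.g P n (D.q * t) - D.q * t = u₂ at *
  field_simp
  ring

/-- The matrix relation between the two times, with the constant terms made explicit. -/
lemma IsSystem.constant_terms {t : ℂ} {P : ℂ → ℕ → ℂ[X]} (h : D.IsSystem t (P t))
    (h' : D.IsSystem (D.q * t) (P (D.q * t))) {n : ℕ} (hn : 1 ≤ n)
    (h51 : D.b5 n ^ 2 * D.q ≠ 1) (h52 : D.b5 n ^ 2 ≠ 1) (hg0 : D.g P n t ≠ 0)
    (hg'0 : D.g P n (D.q * t) ≠ 0) (hg'1 : D.g P n (D.q * t) ≠ D.b6 * (D.q * t))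
    (hg'2 : D.g P n (D.q * t) ≠ D.q * t / D.b6)
    (hfg : D.f P n t * D.g P n t ≠ 1) (htg : t * D.g P n t ≠ D.b5 n) {rp rm : ℂ}
    (hB : ∀ x, D.Admissible t x →
      (-(D.defPlus t x)) • D.Y P n (D.q * t) x = D.defPoly P n t rp rm x * D.Y P n t x) :
    D.f P n t * D.b5 n ≠ t ∧ rp + rm = -(D.q * t * (D.b6 + 1 / D.b6)) ∧
    rp = 1 / (1 - D.b5 n ^ 2) *
      (-(D.q * (t ^ 2 * D.b6 + D.g P n t ^ 2 * D.b5 n ^ 2 * D.b6 -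
          t * D.g P n t * D.b5 n ^ 2 * (1 + D.b6 ^ 2))) / (D.g P n t * D.b6)
        + D.q * t ^ 2 * D.b5 n * (1 - D.b1 * D.g P n t) * (1 - D.b2 * D.g P n t) *
            (1 - D.b3 * D.g P n t) * (1 - D.b4 * D.g P n t) /
            (D.g P n t * (D.f P n t * D.g P n t - 1) * (t * D.g P n t - D.b5 n))
        - D.q * (t - D.b1 * D.b5 n) * (t - D.b2 * D.b5 n) * (t - D.b3 * D.b5 n) *
            (t - D.b4 * D.b5 n) /
            ((t * D.g P n t - D.b5 n) * (D.f P n t * D.b5 n - t))) := by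
  have hD := h.nondegenerate
  have hq := hD.q_ne
  have hq1 := hD.q_sub_one_ne
  have hb5 := b5_ne_zero hD n
  have hb6 := hD.b6_ne
  have ht := h.t_ne
  have g0 := h.isOPS.gam_ne_zero n
  have g1 := h.isOPS.gam_ne_zero (n - 1)
  have g0' := h'.isOPS.gam_ne_zero n
  have g1' := h'.isOPS.gam_ne_zero (n - 1)
  obtain ⟨A, hA⟩ := h.exists_isSpecPoly hn
  obtain ⟨A', hA'⟩ := h'.exists_isSpecPoly hn
  set ρ := gam (P (D.q * t)) n / (D.b6 * gam (P t) n) with hρd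
  set ρm := D.b6 * gam (P t) (n - 1) / gam (P (D.q * t)) (n - 1) with hρmd
  set a := recA (P t) n with ha
  set a' := recA (P (D.q * t)) n with ha'
  have ha0 : a ≠ 0 := h.isOPS.recA_ne_zero n
  have ha0' : a' ≠ 0 := h'.isOPS.recA_ne_zero n
  have hρ : ρ ≠ 0 := div_ne_zero g0' (mul_ne_zero hb6 g0)
  have hρm : ρm * a' = a / ρ := by
    rw [hρmd, ha', ha, hρd, recA, recA]
    field_simp
  have hinv : D.b6 * gam (P t) n / gam (P (D.q * t)) n = 1 / ρ := by
    rw [hρd, one_div_div]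
  have hB00 : ∀ x, D.defPoly P n t rp rm x 0 0 = ρ * (x + rp) := fun x => rfl
  have hB01 : ∀ x, D.defPoly P n t rp rm x 0 1 = -(a * (ρ - 1 / ρ)) := fun x => by
    rw [← hinv]; rfl
  have hB11 : ∀ x, D.defPoly P n t rp rm x 1 1 = ρm * (x + rm) := fun x => rfl
  -- the resonances excluded by regularity
  have hreg : ∀ k : ℤ, D.b6 * t ≠ t / D.b6 * D.q ^ k := h.regular _ (by simp) _ (by simp)
  have hb6' : D.b6 ^ 2 ≠ 1 := fun e => hreg 0 (by
    field_simp; linear_combination e)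
  have hb6q : D.b6 ^ 2 - D.q ≠ 0 := fun e => hreg 1 (by
    rw [zpow_one]; field_simp; linear_combination e)
  have hb6q' : D.b6 ^ 2 * D.q - 1 ≠ 0 := fun e => hreg (-1) (by
    rw [zpow_neg_one]; field_simp; linear_combination e)
  -- evaluation of the compatibility relation
  have compat : ∀ i j x, ((D.b6 * D.q * t - D.q * x) * (t - D.b6 * x)) *
      ((A' i 0).eval x * D.defPoly P n t rp rm x 0 j +
        (A' i 1).eval x * D.defPoly P n t rp rm x 1 j) =
      ((D.b6 * D.q * t - x) * (D.q * t - D.b6 * x)) *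
      (D.defPoly P n t rp rm (D.q * x) i 0 * (A 0 j).eval x +
        D.defPoly P n t rp rm (D.q * x) i 1 * (A 1 j).eval x) := by
    intro i j x
    have hc : ∀ i j, Continuous fun x => D.defPoly P n t rp rm x i j := by
      intro i j
      fin_cases i <;> fin_cases j <;> simp [defPoly] <;> fun_prop
    have hc1 := fun j => hc 0 j
    have hc2 := fun j => hc 1 j
    have hc3 : ∀ j, Continuous fun x => D.defPoly P n t rp rm (D.q * x) i j := fun j =>
      (hc i j).comp (by fun_prop : Continuous fun x : ℂ => D.q * x)
    refine eq_of_admissible (D := D) t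
      (f := fun x => ((D.b6 * D.q * t - D.q * x) * (t - D.b6 * x)) *
        ((A' i 0).eval x * D.defPoly P n t rp rm x 0 j +
          (A' i 1).eval x * D.defPoly P n t rp rm x 1 j))
      (g := fun x => ((D.b6 * D.q * t - x) * (D.q * t - D.b6 * x)) *
        (D.defPoly P n t rp rm (D.q * x) i 0 * (A 0 j).eval x +
          D.defPoly P n t rp rm (D.q * x) i 1 * (A 1 j).eval x))
      (by fun_prop) (by fun_prop) (fun x hx => ?_) x
    have e := congrFun (congrFun (h.compatibility hn hA hA' hB hx) i) j
    simpa only [Matrix.smul_apply, Matrix.mul_apply, Fin.sum_univ_two, Matrix.map_apply,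
      smul_eq_mul] using e
  -- At these two points the scalar on the left of `compat` vanishes while the other does not, as
  -- `b₆² ≠ q` and `b₆² q ≠ 1`; the first row of `B(qx) A(x)` is therefore zero.
  have hBA : ∀ j x, x = D.b6 * t ∨ x = t / D.b6 →
      ρ * (D.q * x + rp) * (A 0 j).eval x = a * (ρ - 1 / ρ) * (A 1 j).eval x := by
    intro j x hx
    have e := compat 0 j x
    have l : (D.b6 * D.q * t - D.q * x) * (t - D.b6 * x) = 0 := by
      rcases hx with rfl | rfl
      · ring
      · field_simp; ring
    have r : (D.b6 * D.q * t - x) * (D.q * t - D.b6 * x) ≠ 0 := by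
      have : (D.b6 * D.q * t - x) * (D.q * t - D.b6 * x) * -1 = t ^ 2 * (D.q - 1) *
            (D.b6 * (D.b6 ^ 2 - D.q)) ∨
          (D.b6 * D.q * t - x) * (D.q * t - D.b6 * x) =
            t ^ 2 * (D.q - 1) * ((D.b6 ^ 2 * D.q - 1) / D.b6) := by
        rcases hx with rfl | rfl
        · left; ring
        · right; field_simp
      intro h0
      rw [h0, zero_mul] at this
      rcases this with e | e
      · exact mul_ne_zero (mul_ne_zero (pow_ne_zero 2 ht) hq1) (mul_ne_zero hb6 hb6q) e.symm
      · exact mul_ne_zero (mul_ne_zero (pow_ne_zero 2 ht) hq1) (div_ne_zero hb6q' hb6) e.symm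
    rw [l, zero_mul, eq_comm] at e
    have e' := (mul_eq_zero.1 e).resolve_left r
    rw [hB00, hB01] at e'
    linear_combination e'
  -- Here the scalar on the right vanishes, so the `(0,1)` entry of `A' B` is zero.
  have hAB : ∀ x, x = D.b6 * (D.q * t) ∨ x = D.q * t / D.b6 →
      (A' 0 0).eval x * (a * (ρ - 1 / ρ)) = (A' 0 1).eval x * (ρm * (x + rm)) := by
    intro x hx
    have e := compat 0 1 x
    have l : (D.b6 * D.q * t - x) * (D.q * t - D.b6 * x) = 0 := by
      rcases hx with rfl | rfl
      · ring
      · field_simp; ring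
    have r : (D.b6 * D.q * t - D.q * x) * (t - D.b6 * x) ≠ 0 := by
      have : (D.b6 * D.q * t - D.q * x) * (t - D.b6 * x) = t ^ 2 * (D.q - 1) *
            (D.q * D.b6 * (D.b6 ^ 2 * D.q - 1)) ∨
          (D.b6 * D.q * t - D.q * x) * (t - D.b6 * x) * -1 =
            t ^ 2 * (D.q - 1) * (D.q * (D.b6 ^ 2 - D.q) / D.b6) := by
        rcases hx with rfl | rfl
        · left; ring
        · right; field_simp; ring
      intro h0
      rw [h0, zero_mul] at this
      rcases this with e | e
      · exact mul_ne_zero (mul_ne_zero (pow_ne_zero 2 ht) hq1)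
          (mul_ne_zero (mul_ne_zero hq hb6) hb6q') e.symm
      · exact mul_ne_zero (mul_ne_zero (pow_ne_zero 2 ht) hq1)
          (div_ne_zero (mul_ne_zero hq hb6q) hb6) e.symm
    rw [l, zero_mul] at e
    have e' := (mul_eq_zero.1 e).resolve_left r
    rw [hB01, hB11] at e'
    linear_combination -e'
  have a00 : ∀ x, (A 0 0).eval x = -(D.b5 n * D.b6) * x ^ 3 + (A 0 0).coeff 2 * x ^ 2 +
      (A 0 0).coeff 1 * x + D.b6 * t := fun x => by
    rw [eval_of_natDegree_le_three hA.natDegree₀₀, hA.coeff₀₀, hA.coeff_zero₀₀]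
  have a11 : ∀ x, (A 1 1).eval x = -(D.b6 / D.b5 n) * x ^ 3 + (A 1 1).coeff 2 * x ^ 2 +
      (A 1 1).coeff 1 * x + D.b6 * t := fun x => by
    rw [eval_of_natDegree_le_three hA.natDegree₁₁, hA.coeff₁₁, hA.coeff_zero₁₁]
  have a10 : ∀ x, (A 1 0).eval x = (A 1 0).coeff 2 * x ^ 2 + (A 1 0).coeff 1 * x := fun x => by
    rw [eval_of_natDegree_le_two hA.natDegree₁₀, hA.coeff_zero₁₀, add_zero]
  have a01 := fun x => h.eval_specPoly_zero_one hn hA h51 x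
  have a00' : ∀ x, (A' 0 0).eval x = -(D.b5 n * D.b6) * x ^ 3 + (A' 0 0).coeff 2 * x ^ 2 +
      (A' 0 0).coeff 1 * x + D.b6 * (D.q * t) := fun x => by
    rw [eval_of_natDegree_le_three hA'.natDegree₀₀, hA'.coeff₀₀, hA'.coeff_zero₀₀]
  have a01' := fun x => h'.eval_specPoly_zero_one hn hA' h51 x
  have hfe := h'.eval_specPoly_g hn hA' hg'0 (sub_ne_zero.2 hg'1) (fun e => hg'2 (by
    field_simp; linear_combination e))
  rw [a00'] at hfe
  have hR := ratio_relation (rm := rm) hq ht hb5 hb6 hb6' ha0 hρ hρm hg'0 hg'1 hg'2 hfe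
    (fun x hx => by rw [← a00', ← a01']; exact hAB x hx)
  have hft := mul_b5_ne ht hρ h51 hR
  refine ⟨hft, ?_, ?_⟩
  · have d1 := h.det_defPoly h' hn hB 1
    have d2 := h.det_defPoly h' hn hB (-1)
    rw [Matrix.det_fin_two] at d1 d2
    rw [hB00, hB11] at d1 d2
    have e1 : D.defPoly P n t rp rm (-1) 0 1 = D.defPoly P n t rp rm 1 0 1 := rfl
    have e2 : D.defPoly P n t rp rm (-1) 1 0 = D.defPoly P n t rp rm 1 1 0 := rfl
    rw [e1, e2] at d2
    have e3 : a' * (ρ * ρm) = a := by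
      rw [mul_comm, mul_assoc, hρm]; field_simp
    have e4 : a * (rp + rm + D.q * t * (D.b6 + 1 / D.b6)) * 2 = 0 := by
      rw [defPlus, defMinus] at d1 d2
      have e5 : D.b6⁻¹ * D.b6 = 1 := inv_mul_cancel₀ hb6
      rw [one_div]
      linear_combination d1 - d2 - 2 * (rp + rm) * e3
        - (2 * a * D.q * t * D.b6) * e5
    have e6 := (mul_eq_zero.1 ((mul_eq_zero.1 e4).resolve_right two_ne_zero)).resolve_left ha0
    linear_combination e6
  · have hprod := hD.prod_eq
    set e1 := D.b1 + D.b2 + D.b3 + D.b4 with he1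
    set e2 := D.b1 * D.b2 + D.b1 * D.b3 + D.b1 * D.b4 + D.b2 * D.b3 + D.b2 * D.b4 +
      D.b3 * D.b4 with he2
    set e3 := D.b1 * D.b2 * D.b3 + D.b1 * D.b2 * D.b4 + D.b1 * D.b3 * D.b4 +
      D.b2 * D.b3 * D.b4 with he3
    have s1 : ∀ y z : ℂ, (y - D.b1 * z) * (y - D.b2 * z) * (y - D.b3 * z) * (y - D.b4 * z) =
        y ^ 4 - e1 * z * y ^ 3 + e2 * z ^ 2 * y ^ 2 - e3 * z ^ 3 * y + z ^ 4 := fun y z => by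
      rw [he1, he2, he3]; linear_combination z ^ 4 * hprod
    have key := constant_term_formula (e1 := e1) (e2 := e2) (e3 := e3) hq ht hb5 hb6 hb6' ha0 hρ
      h51 h52 hfg hg0 htg hR
      (fun x => by
        rw [← a00, ← a11, ← a01, ← a10, h.det_specPoly hn hA x, specPlus, specMinus]
        linear_combination (D.b6 * ((t - D.b6 * x) * (D.b6 * t - x))) * s1 1 x)
      (fun x hx => by rw [← a00, ← a10]; exact hBA 0 x hx)
      (fun x hx => by rw [← a01, ← a11]; exact hBA 1 x hx)
    have p1 := s1 1 (D.g P n t)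
    have p2 := s1 t (D.b5 n)
    rw [key]
    congr 2
    · congr 2
      linear_combination (-(D.q * t ^ 2 * D.b5 n)) * p1
    · congr 1
      linear_combination (-D.q) * p2

end QJacobi

/-! ### Assembly of the deformation matrix from its two constant terms. -/

theorem mainTheorem4 (D : QJacobi) (t : ℂ) (P : ℂ → ℕ → ℂ[X]) (n : ℕ) (hn : 1 ≤ n)
    (q b1 b2 b3 b4 b5 b6 : ℂ)
    (hq : q = D.q) (hb1 : b1 = D.b1) (hb2 : b2 = D.b2) (hb3 : b3 = D.b3) (hb4 : b4 = D.b4)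
    (hb5 : b5 = D.b5 n) (hb6 : b6 = D.b6)
    (hq0 : q ≠ 0) (hq1 : ‖q‖ ≠ 1) (ht : t ≠ 0) (hb60 : b6 ≠ 0) (hb : b1 * b2 * b3 * b4 = 1)
    (hreg : D.Regular t) (hx0 : D.IsTerminal t D.x0) (hx1 : D.IsTerminal t D.x1)
    (hP : D.IsOPS t (P t)) (hP' : D.IsOPS (q * t) (P (q * t)))
    (h51 : b5 ^ 2 ≠ q⁻¹) (h52 : b5 ^ 2 ≠ 1) (h53 : b5 ^ 2 ≠ q)
    (f g g' : ℂ) (hf : f = D.f P n t) (hg : g = D.g P n t) (hg' : g' = D.g P n (q * t))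
    (hg0 : g ≠ 0) (hg1 : g ≠ b6 * t) (hg2 : g ≠ b6⁻¹ * t)
    (hg'0 : g' ≠ 0) (hg'1 : g' ≠ b6 * (q * t)) (hg'2 : g' ≠ b6⁻¹ * (q * t))
    (hfg : f * g ≠ 1) (htg : t * g ≠ b5)
    (a γ γ' δ δ' : ℂ) (ha : a = QJacobi.recA (P t) n)
    (hγ : γ = QJacobi.gam (P t) n) (hγ' : γ' = QJacobi.gam (P (q * t)) n)
    (hδ : δ = QJacobi.gam (P t) (n - 1)) (hδ' : δ' = QJacobi.gam (P (q * t)) (n - 1))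
    (Rplus Rminus : ℂ → ℂ) (Pplus Pminus : ℂ) (Bstar : ℂ → Matrix (Fin 2) (Fin 2) ℂ)
    (hRplus : ∀ x, Rplus x = γ' / (b6 * γ) * (x + 1 / (1 - b5 ^ 2) *
      (-(q * (t ^ 2 * b6 + g ^ 2 * b5 ^ 2 * b6 - t * g * b5 ^ 2 * (1 + b6 ^ 2))) / (g * b6)
        + q * t ^ 2 * b5 * (1 - b1 * g) * (1 - b2 * g) * (1 - b3 * g) * (1 - b4 * g) /
            (g * (f * g - 1) * (t * g - b5))
        - q * (t - b1 * b5) * (t - b2 * b5) * (t - b3 * b5) * (t - b4 * b5) /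
            ((t * g - b5) * (f * b5 - t)))))
    (hRminus : ∀ x, Rminus x = b6 * δ / δ' * (x + 1 / (1 - b5 ^ 2) *
      (q * (t ^ 2 * b6 + g ^ 2 * b5 ^ 2 * b6 - t * g * (1 + b6 ^ 2)) / (g * b6)
        - q * t ^ 2 * b5 * (1 - b1 * g) * (1 - b2 * g) * (1 - b3 * g) * (1 - b4 * g) /
            (g * (f * g - 1) * (t * g - b5))
        + q * (t - b1 * b5) * (t - b2 * b5) * (t - b3 * b5) * (t - b4 * b5) /
            ((t * g - b5) * (f * b5 - t)))))
    (hPplus : Pplus = a * (γ' / (b6 * γ) - b6 * γ / γ'))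
    (hPminus : Pminus = a * (δ' / (b6 * δ) - b6 * δ / δ'))
    (hBstar : ∀ x, Bstar x = !![Rplus x, -Pplus; Pminus, Rminus x]) :
    γ ≠ 0 ∧ γ' ≠ 0 ∧ δ ≠ 0 ∧ δ' ≠ 0 ∧ f * b5 ≠ t ∧
    ∀ x, D.Admissible t x →
      ((D.mean (D.YT P n x) t).det ≠ 0 → D.defStar P n t x = Bstar x) ∧
      (-(D.defPlus t x)) • D.Y P n (q * t) x = Bstar x * D.Y P n t x := by
  subst hq hb1 hb2 hb3 hb4 hb5 hb6 hf hg hg' ha hγ hγ' hδ hδ'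
  have hD : D.Nondegenerate := ⟨hq0, hq1, hb60, hb⟩
  have S : D.IsSystem t (P t) :=
    ⟨hD, ht, hreg, hx0.isTerminalLattice, hx1.isTerminalLattice, hP⟩
  have S' : D.IsSystem (D.q * t) (P (D.q * t)) :=
    ⟨hD, mul_ne_zero hq0 ht, hreg.q_mul hD, hx0.isTerminalLattice_mul, hx1.isTerminalLattice_mul,
      hP'⟩
  obtain ⟨rp, rm, hB⟩ := S.exists_defPoly S' hn
  have h51' : D.b5 n ^ 2 * D.q ≠ 1 := fun e => h51 (eq_inv_of_mul_eq_one_left e)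
  obtain ⟨hft, hsum, hrp⟩ := S.constant_terms S' hn h51' h52 hg0 hg'0 hg'1
    (fun e => hg'2 (by rw [e]; ring)) hfg htg hB
  have hd : 1 - D.b5 n ^ 2 ≠ 0 := sub_ne_zero.2 h52.symm
  -- Obtained from `hsum` and `hrp`: the two fractions only change sign, so they are treated as
  -- opaque and just the first term is recomputed.
  have hrm : rm = 1 / (1 - D.b5 n ^ 2) *
      (D.q * (t ^ 2 * D.b6 + D.g P n t ^ 2 * D.b5 n ^ 2 * D.b6 - t * D.g P n t * (1 + D.b6 ^ 2)) /
          (D.g P n t * D.b6)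
        - D.q * t ^ 2 * D.b5 n * (1 - D.b1 * D.g P n t) * (1 - D.b2 * D.g P n t) *
            (1 - D.b3 * D.g P n t) * (1 - D.b4 * D.g P n t) /
            (D.g P n t * (D.f P n t * D.g P n t - 1) * (t * D.g P n t - D.b5 n))
        + D.q * (t - D.b1 * D.b5 n) * (t - D.b2 * D.b5 n) * (t - D.b3 * D.b5 n) *
            (t - D.b4 * D.b5 n) / ((t * D.g P n t - D.b5 n) * (D.f P n t * D.b5 n - t))) := by
    have e1 : rm = -(D.q * t * (D.b6 + 1 / D.b6)) - rp := by linear_combination hsum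
    rw [e1, hrp]
    generalize D.q * t ^ 2 * D.b5 n * (1 - D.b1 * D.g P n t) * (1 - D.b2 * D.g P n t) *
      (1 - D.b3 * D.g P n t) * (1 - D.b4 * D.g P n t) /
      (D.g P n t * (D.f P n t * D.g P n t - 1) * (t * D.g P n t - D.b5 n)) = u₁
    generalize D.q * (t - D.b1 * D.b5 n) * (t - D.b2 * D.b5 n) * (t - D.b3 * D.b5 n) *
      (t - D.b4 * D.b5 n) / ((t * D.g P n t - D.b5 n) * (D.f P n t * D.b5 n - t)) = u₂
    field_simp
    ring
  have hBs : ∀ x, D.defPoly P n t rp rm x = Bstar x := fun x => by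
    rw [hBstar, hRplus, hRminus, hPplus, hPminus, ← hrp, ← hrm]
    rfl
  refine ⟨hP.gam_ne_zero n, hP'.gam_ne_zero n, hP.gam_ne_zero _, hP'.gam_ne_zero _, hft,
    fun x hx => ?_⟩
  have hBx := hB x hx
  rw [hBs] at hBx
  exact ⟨S.defStar_eq hn hx hBx, hBx⟩
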